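/- A convex cost function is a convex function $\theta:\mathbb R\to[0,\infty)$ with $\theta(0)=0$; it has superlinear growth if $\theta'(r)\to\infty$ as $r\to\infty$, and $\theta^*(s)=\sup_{r\in\mathbb R}(sr-\theta(r))$. Let $\mathcal F$ be the set of convex functions $f:\mathbb R^n\to\mathbb R$ of class $C^2$ such that for every $x\in\mathbb R^n$ there is $\lambda\in\mathbb R$ with $\mathrm{Hess} f(x)\,\nabla f(x)=\lambda\nabla f(x)$. For a convex cost function $\theta$ with superlinear growth and $f\in\mathcal F$, consider the Cauchy problem $$(\mathrm{HJ}_{\theta,f})\qquad \partial_t v(x,t)+\theta^*(\|\nabla_x v(x,t)\|)=0\ \text{ on } \mathbb R^n\times(0,\infty),\qquad v(x,0)=f(x)\ \text{ on }\mathbb R^n,$$ where $\|\cdot\|$ is the Euclidean norm and $v$ is continuous on $\mathbb R^n\times[0,\infty)$. **Theorem.** Let $\theta$ be a differentiable, strictly convex cost function with superlinear growth, let $f\in\mathcal F$, and let $v$ be a viscosity solution of $(\mathrm{HJ}_{\theta,f})$. Let $\theta_1,\theta_2$ be convex cost functions with superlinear growth such that $\theta_1+\theta_2=\theta$, and assume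 that $\theta_1'\circ(\theta')^{-1}$ is of class $C^1$ on $[0,\infty)$ (equivalently, $\theta_2'\circ(\theta')^{-1}$ is), that is, $\theta_1'=G\circ\theta'$ on $[0,\infty)$ for some $G:\mathbb R\to\mathbb R$ of class $C^1$. Then there are $f_1,f_2\in\mathcal F$ and, for $i=1,2$, a viscosity solution $v_i$ of $(\mathrm{HJ}_{\theta_i,f_i})$, which moreover is differentiable at every point of $\mathbb R^n\times(0,\infty)$ and satisfies the equation there pointwise, such that $v=v_1+v_2$ on $\mathbb R^n\times[0,\infty)$. -/

import Mathlib

open Set Filter Topology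

noncomputable section

namespace HamiltonJacobi

/-- A convex cost function: a convex function on the line, nonnegative and vanishing at `0`. -/
structure IsConvexCost (θ : ℝ → ℝ) : Prop where
  convex : ConvexOn ℝ univ θ
  zero : θ 0 = 0
  nonneg : ∀ r, 0 ≤ θ r

/-- Superlinear growth: `θ'(r) → ∞` as `r → ∞`. -/
def Superlinear (θ : ℝ → ℝ) : Prop :=
  Tendsto (deriv θ) atTop atTop

/-- The convex conjugate `θ*(s) = sup_r (s r - θ(r))`. For a superlinear convex cost the supremum is
finite for every `s ≥ 0`, and only such arguments `s = ‖∇v‖` occur below. -/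
def conjugate (θ : ℝ → ℝ) (s : ℝ) : ℝ :=
  ⨆ r : ℝ, (s * r - θ r)

/-- The class `𝓕`: convex functions of class `C²` on `ℝⁿ` such that at each point
`Hess f(x) ∇f(x) = lam ∇f(x)` for some real `lam`. The derivative of the gradient field is the
Hessian, as an endomorphism of `ℝⁿ`. -/
structure ClassF {n : ℕ} (f : EuclideanSpace ℝ (Fin n) → ℝ) : Prop where
  convex : ConvexOn ℝ univ f
  contDiff : ContDiff ℝ 2 f
  eigen : ∀ x, ∃ lam : ℝ, fderiv ℝ (gradient f) x (gradient f x) = lam • gradient f x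

/-- The left-hand side `∂ₜ w(x,t) + θ*(‖∇ₓ w(x,t)‖)` of the Hamilton–Jacobi equation. -/
def hjOperator {n : ℕ} (θ : ℝ → ℝ) (w : EuclideanSpace ℝ (Fin n) → ℝ → ℝ)
    (x : EuclideanSpace ℝ (Fin n)) (t : ℝ) : ℝ :=
  deriv (fun s => w x s) t + conjugate θ ‖gradient (fun y => w y t) x‖

/-- `v` is a viscosity solution of `∂ₜ v + θ*(‖∇v‖) = 0` on `ℝⁿ × (0,∞)`, continuous on
`ℝⁿ × [0,∞)`, with `v(·,0) = f`. Values of `v` at negative times play no role. -/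
structure IsViscositySolution {n : ℕ} (θ : ℝ → ℝ) (f : EuclideanSpace ℝ (Fin n) → ℝ)
    (v : EuclideanSpace ℝ (Fin n) → ℝ → ℝ) : Prop where
  continuousOn : ContinuousOn (fun p : EuclideanSpace ℝ (Fin n) × ℝ => v p.1 p.2)
    (univ ×ˢ Ici (0 : ℝ))
  initial : ∀ x, v x 0 = f x
  subsolution : ∀ φ : EuclideanSpace ℝ (Fin n) → ℝ → ℝ,
    ContDiff ℝ 1 (fun p : EuclideanSpace ℝ (Fin n) × ℝ => φ p.1 p.2) →
    ∀ (x : EuclideanSpace ℝ (Fin n)) (t : ℝ), 0 < t →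
      IsLocalMax (fun p : EuclideanSpace ℝ (Fin n) × ℝ => v p.1 p.2 - φ p.1 p.2) (x, t) →
      hjOperator θ φ x t ≤ 0
  supersolution : ∀ φ : EuclideanSpace ℝ (Fin n) → ℝ → ℝ,
    ContDiff ℝ 1 (fun p : EuclideanSpace ℝ (Fin n) × ℝ => φ p.1 p.2) →
    ∀ (x : EuclideanSpace ℝ (Fin n)) (t : ℝ), 0 < t →
      IsLocalMin (fun p : EuclideanSpace ℝ (Fin n) × ℝ => v p.1 p.2 - φ p.1 p.2) (x, t) →
      0 ≤ hjOperator θ φ x t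

/-- `v` is a classical solution: continuous on `ℝⁿ × [0,∞)` with `v(·,0) = f`, differentiable at
every point of `ℝⁿ × (0,∞)`, where the equation `∂ₜ v + θ*(‖∇v‖) = 0` holds pointwise. -/
structure IsClassicalSolution {n : ℕ} (θ : ℝ → ℝ) (f : EuclideanSpace ℝ (Fin n) → ℝ)
    (v : EuclideanSpace ℝ (Fin n) → ℝ → ℝ) : Prop where
  continuousOn : ContinuousOn (fun p : EuclideanSpace ℝ (Fin n) × ℝ => v p.1 p.2)
    (univ ×ˢ Ici (0 : ℝ))
  initial : ∀ x, v x 0 = f x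
  differentiableAt : ∀ (x : EuclideanSpace ℝ (Fin n)) (t : ℝ), 0 < t →
    DifferentiableAt ℝ (fun p : EuclideanSpace ℝ (Fin n) × ℝ => v p.1 p.2) (x, t)
  equation : ∀ (x : EuclideanSpace ℝ (Fin n)) (t : ℝ), 0 < t → hjOperator θ v x t = 0

end HamiltonJacobi

end

/-! Any viscosity solution `v` is given by the Hopf–Lax formula, with an attained minimum: `v(x,t) =
min_y (f(y) + t θ(‖x - y‖ / t))`. A minimizer `y` satisfies `∇f(y) = radial θ' q` with `q = (x - y)
/ t`, that is, `∇f(y)` has the direction of `q` and length `θ'(‖q‖)`.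

Since `θ₁' = G ∘ θ'`, applying `radial G` to this condition gives `radial G (∇f(y)) = radial θ₁' q`.
So one wants `∇f₁ = radial G (∇f)` and `f₂ = f - f₁`. The field is a gradient because its Jacobian
is `radialDeriv G (∇f)`, a combination of the identity and the projection onto `∇f`, composed with
the Hessian, which has `∇f` as an eigenvector; the product is symmetric (`ClassF.exists_potential`).
It is positive semidefinite because `G` is monotone on `[0, ∞)`, so `f₁`, and likewise `f₂`, is in
the class (`ClassF.of_hasGradientAt`).

The same `y` is then critical for both problems `(θᵢ, fᵢ)`, and by convexity of `fᵢ` it is a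
minimizer. Hence the values `vᵢ = fᵢ(y) + t θᵢ(‖q‖)` add up to `v`. Each `vᵢ` is squeezed between an
affine function and the action from a fixed `y`, hence differentiable, and solves the equation
pointwise.

The Hopf–Lax formula is proved locally, without growth conditions. Moving barriers bound `v` above
by the action of segments (`IsViscositySolution.le_add_action`); a backward barrier yields segments
along which `v` pays the full action (`IsViscositySolution.exists_action_le`). Strict convexity
forbids corners, so such segments continue straight down to time `0`
(`IsViscositySolution.exists_eq_hopfLax`). -/

noncomputable section

namespace HamiltonJacobi

/-! ### Touching functions and convexity on the line. -/

/-- A function squeezed between two functions which touch it at a point and are differentiable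
there is differentiable at that point. -/
theorem hasFDerivAt_of_squeeze {E : Type*} [NormedAddCommGroup E] [NormedSpace ℝ E]
    {l w u : E → ℝ} {x : E} {D : E →L[ℝ] ℝ} (hl : HasFDerivAt l D x) (hu : HasFDerivAt u D x)
    (hlw : ∀ᶠ y in 𝓝 x, l y ≤ w y) (hwu : ∀ᶠ y in 𝓝 x, w y ≤ u y)
    (hlx : l x = w x) (hux : u x = w x) : HasFDerivAt w D x := by
  rw [hasFDerivAt_iff_isLittleO] at hl hu ⊢
  rw [Asymptotics.isLittleO_iff] at hl hu ⊢
  intro c hc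
  filter_upwards [hl hc, hu hc, hlw, hwu] with y h1 h2 h3 h4
  rw [Real.norm_eq_abs, abs_le] at h1 h2 ⊢
  constructor <;> linarith [h1.1, h1.2, h2.1, h2.2]

theorem exists_subgradient {g : ℝ → ℝ} (hg : ConvexOn ℝ univ g) (r : ℝ) :
    ∃ a, ∀ r', g r + a * (r' - r) ≤ g r' := by
  have hr : r ∈ interior (univ : Set ℝ) := by simp
  refine ⟨derivWithin g (Ioi r) r, fun r' => ?_⟩
  rcases lt_trichotomy r r' with h | h | h
  · have := hg.rightDeriv_le_slope_of_mem_interior hr (mem_univ r') h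
    rw [slope_def_field, le_div_iff₀ (by linarith)] at this
    linarith
  · simp [h]
  · have h1 := hg.slope_le_leftDeriv_of_mem_interior (mem_univ r') hr h
    have h2 := hg.leftDeriv_le_rightDeriv_of_mem_interior hr
    have h3 := h1.trans h2
    rw [slope_def_field, div_le_iff₀ (by linarith)] at h3
    linarith

theorem tangent_le {g : ℝ → ℝ} (hg : ConvexOn ℝ univ g) {r d : ℝ} (hd : HasDerivAt g d r)
    (r' : ℝ) : g r + d * (r' - r) ≤ g r' := by
  rcases lt_trichotomy r r' with h | h | h
  · have := hg.le_slope_of_hasDerivAt (mem_univ r) (mem_univ r') h hd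
    rw [slope_def_field, le_div_iff₀ (by linarith)] at this
    linarith
  · simp [h]
  · have := hg.slope_le_of_hasDerivAt (mem_univ r') (mem_univ r) h hd
    rw [slope_def_field, div_le_iff₀ (by linarith)] at this
    linarith

/-- If the sum of two convex functions is differentiable, so is each summand. -/
theorem differentiable_of_add {g₁ g₂ g : ℝ → ℝ} (h₁ : ConvexOn ℝ univ g₁)
    (h₂ : ConvexOn ℝ univ g₂) (hsum : ∀ r, g₁ r + g₂ r = g r) (hg : Differentiable ℝ g) :
    Differentiable ℝ g₁ := by
  intro r
  obtain ⟨a, ha⟩ := exists_subgradient h₁ r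
  obtain ⟨b, hb⟩ := exists_subgradient h₂ r
  have hd := (hg r).hasDerivAt
  -- A sum of subgradients of the summands is a subgradient of `g`, which has only one. Then `g₁`
  -- lies between its support line of slope `a` and `g` minus the support line of `g₂`, whose
  -- derivative is also `a`.
  have hab : a + b = deriv g r := by
    have h0 : IsLocalMin (fun r' => g r' - (a + b) * (r' - r)) r := by
      refine Eventually.of_forall fun r' => ?_
      have := ha r'; have := hb r'
      simp only [sub_self, mul_zero, sub_zero]
      linarith [hsum r, hsum r']
    have h1 : HasDerivAt (fun r' => g r' - (a + b) * (r' - r)) (deriv g r - (a + b)) r := by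
      have := hd.sub (((hasDerivAt_id r).sub_const r).const_mul (a + b))
      rw [mul_one] at this
      exact this
    linarith [h0.hasDerivAt_eq_zero h1]
  have hl : HasDerivAt (fun r' => g₁ r + a * (r' - r)) a r := by
    simpa using (((hasDerivAt_id r).sub_const r).const_mul a).const_add (g₁ r)
  have hu : HasDerivAt (fun r' => g r' - (g₂ r + b * (r' - r))) a r := by
    have := hd.sub ((((hasDerivAt_id r).sub_const r).const_mul b).const_add (g₂ r))
    have e : deriv g r - b * 1 = a := by linarith
    rw [e] at this
    exact this
  refine (hasFDerivAt_of_squeeze (w := g₁) hl.hasFDerivAt hu.hasFDerivAt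
    (Eventually.of_forall ha) (Eventually.of_forall fun r' => ?_) (by simp) ?_).differentiableAt
  · have := hb r'; linarith [hsum r']
  · linarith [hsum r]

/-! ### Costs and their conjugates. -/

namespace IsConvexCost

theorem tangent {θ : ℝ → ℝ} (hθ : IsConvexCost θ)
    (hd : Differentiable ℝ θ) (r r' : ℝ) : θ r + deriv θ r * (r' - r) ≤ θ r' :=
  tangent_le hθ.convex (hd r).hasDerivAt r'

theorem deriv_zero {θ : ℝ → ℝ} (hθ : IsConvexCost θ) : deriv θ 0 = 0 :=
  IsLocalMin.deriv_eq_zero (Eventually.of_forall fun r => by rw [hθ.zero]; exact hθ.nonneg r)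

theorem monotone_deriv {θ : ℝ → ℝ} (hθ : IsConvexCost θ)
    (hd : Differentiable ℝ θ) : Monotone (deriv θ) :=
  monotoneOn_univ.1 (hθ.convex.monotoneOn_deriv fun x _ => hd x)

theorem deriv_nonneg {θ : ℝ → ℝ} (hθ : IsConvexCost θ)
    (hd : Differentiable ℝ θ) {r : ℝ} (hr : 0 ≤ r) : 0 ≤ deriv θ r :=
  hθ.deriv_zero ▸ hθ.monotone_deriv hd hr

theorem mono {θ : ℝ → ℝ} (hθ : IsConvexCost θ)
    (hd : Differentiable ℝ θ) {r r' : ℝ} (hr : 0 ≤ r) (h : r ≤ r') : θ r ≤ θ r' := by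
  have := hθ.tangent hd r r'
  have := mul_nonneg (hθ.deriv_nonneg hd hr) (sub_nonneg.2 h)
  linarith

theorem pos {θ : ℝ → ℝ} (hθ : IsConvexCost θ)
    (hs : StrictConvexOn ℝ univ θ) {r : ℝ} (hr : r ≠ 0) : 0 < θ r := by
  have h := hs.2 (mem_univ r) (mem_univ 0) hr (by norm_num : (0:ℝ) < 1/2)
    (by norm_num : (0:ℝ) < 1/2) (by norm_num)
  have := hθ.nonneg ((1/2 : ℝ) • r + (1/2 : ℝ) • 0)
  rw [hθ.zero] at h
  simp only [smul_eq_mul, mul_zero, add_zero] at h this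
  linarith

theorem strict_mono {θ : ℝ → ℝ} (hθ : IsConvexCost θ)
    (hs : StrictConvexOn ℝ univ θ) {r r' : ℝ} (hr : 0 ≤ r) (h : r < r') :
    θ r < θ r' := by
  have hr' : 0 < r' := by linarith
  have hp := hθ.pos hs hr'.ne'
  have hle := hθ.convex.2 (mem_univ r') (mem_univ 0) (div_nonneg hr hr'.le)
    (sub_nonneg.2 ((div_le_one hr').2 h.le)) (add_sub_cancel _ _)
  simp only [smul_eq_mul, mul_zero, add_zero, hθ.zero, div_mul_cancel₀ r hr'.ne'] at hle
  have : r / r' * θ r' < 1 * θ r' := mul_lt_mul_of_pos_right ((div_lt_one hr').2 h) hp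
  linarith

theorem bddAbove {θ : ℝ → ℝ} (hθ : IsConvexCost θ)
    (hd : Differentiable ℝ θ) (hsup : Superlinear θ) {s : ℝ} (hs : 0 ≤ s) :
    BddAbove (range fun r => s * r - θ r) := by
  obtain ⟨R, hR, hR0⟩ := ((hsup.eventually_ge_atTop s).and (eventually_ge_atTop 0)).exists
  refine ⟨deriv θ R * R, ?_⟩
  rintro _ ⟨r, rfl⟩
  have h0 := mul_nonneg (hθ.deriv_nonneg hd hR0) hR0
  simp only
  rcases le_total 0 r with h | h
  · have := hθ.tangent hd R r
    have := mul_nonneg (sub_nonneg.2 hR) h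
    linarith [hθ.nonneg R]
  · have := mul_nonneg hs (neg_nonneg.2 h)
    linarith [hθ.nonneg r]

theorem le_conjugate {θ : ℝ → ℝ} (hθ : IsConvexCost θ)
    (hd : Differentiable ℝ θ) (hsup : Superlinear θ) {s : ℝ} (hs : 0 ≤ s)
    (r : ℝ) : s * r - θ r ≤ conjugate θ s :=
  le_ciSup (hθ.bddAbove hd hsup hs) r

theorem conjugate_deriv {θ : ℝ → ℝ} (hθ : IsConvexCost θ)
    (hd : Differentiable ℝ θ) (r : ℝ) :
    conjugate θ (deriv θ r) = r * deriv θ r - θ r := by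
  have key : ∀ r', deriv θ r * r' - θ r' ≤ r * deriv θ r - θ r := fun r' => by
    have := hθ.tangent hd r r'
    linarith
  refine le_antisymm (ciSup_le key) ?_
  rw [mul_comm r]
  exact le_ciSup (f := fun r' => deriv θ r * r' - θ r')
    ⟨_, by rintro _ ⟨r', rfl⟩; exact key r'⟩ r

/-- The perspective `τ θ(a / τ)` blows up as `τ → 0`, for `a = 1`. -/
theorem exists_perspective_gt {θ : ℝ → ℝ} (hθ : IsConvexCost θ)
    (hd : Differentiable ℝ θ) (hsup : Superlinear θ) (B : ℝ) :
    ∃ τ₀ > 0, ∀ τ, 0 < τ → τ < τ₀ → B < τ * θ τ⁻¹ := by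
  set s := |B| + 1
  set C := |conjugate θ s|
  refine ⟨1 / (C + 1), by positivity, fun τ h0 h1 => ?_⟩
  have h2 := hθ.le_conjugate hd hsup (s := s) (by positivity) τ⁻¹
  have h3 : conjugate θ s ≤ C := le_abs_self _
  rw [lt_div_iff₀ (by positivity)] at h1
  have h4 : s - τ * θ τ⁻¹ ≤ τ * C := by
    have := mul_le_mul_of_nonneg_left (h2.trans h3) h0.le
    rw [mul_sub, mul_left_comm, mul_inv_cancel₀ h0.ne'] at this
    linarith
  have : B ≤ |B| := le_abs_self B
  simp only [s] at h4
  nlinarith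

theorem exists_deriv_eq {θ : ℝ → ℝ} (hθ : IsConvexCost θ)
    (hd : Differentiable ℝ θ) (hsup : Superlinear θ) {s : ℝ} (hs : 0 ≤ s) :
    ∃ r, 0 ≤ r ∧ deriv θ r = s := by
  obtain ⟨R, hR, hR0⟩ := ((hsup.eventually_ge_atTop s).and (eventually_ge_atTop 0)).exists
  -- Darboux: a derivative has the intermediate value property even before its continuity is known.
  have := (ordConnected_Ici (a := (0 : ℝ))).image_deriv (f := θ) fun x _ => hd x
  obtain ⟨r, hr, h⟩ := this.out ⟨0, self_mem_Ici, hθ.deriv_zero⟩ ⟨R, hR0, rfl⟩ ⟨hs, hR⟩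
  exact ⟨r, hr, h⟩

/-- A monotone surjection of the line is continuous. Superlinearity controls only `+∞`, so the
derivative is replaced by the identity on the negative half-line to get a surjection. -/
theorem continuousOn_deriv {θ : ℝ → ℝ} (hθ : IsConvexCost θ)
    (hd : Differentiable ℝ θ) (hsup : Superlinear θ) :
    ContinuousOn (deriv θ) (Ici 0) := by
  have hmono := hθ.monotone_deriv hd
  set k : ℝ → ℝ := fun r => if 0 ≤ r then deriv θ r else r with hk
  have hk1 : Monotone k := by
    intro r r' h
    simp only [hk]
    split_ifs with h1 h2 h2
    · exact hmono h
    · linarith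
    · linarith [hθ.deriv_nonneg hd h2]
    · exact h
  have hk2 : Function.Surjective k := by
    intro s
    rcases le_or_gt 0 s with h | h
    · obtain ⟨r, h0, hr⟩ := hθ.exists_deriv_eq hd hsup h
      exact ⟨r, by simp [hk, h0, hr]⟩
    · exact ⟨s, by simp [hk, h]⟩
  refine (hk1.continuous_of_surjective hk2).continuousOn.congr fun r hr => ?_
  simp [hk, mem_Ici.1 hr]

end IsConvexCost

/-! ### Radial rescalings and the Lagrangian `q ↦ θ ‖q‖`. -/

section Radial

variable {E : Type*} [NormedAddCommGroup E] [InnerProductSpace ℝ E]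

/-- The vector pointing in the direction of `p` with signed length `g ‖p‖`. -/
def radial (g : ℝ → ℝ) (p : E) : E := (g ‖p‖ / ‖p‖) • p

theorem radial_zero (g : ℝ → ℝ) : radial g (0 : E) = 0 := by simp [radial]

theorem norm_radial {g : ℝ → ℝ} (h0 : g 0 = 0) (hg : ∀ r, 0 ≤ r → 0 ≤ g r) (p : E) :
    ‖radial g p‖ = g ‖p‖ := by
  rcases eq_or_ne p 0 with rfl | hp
  · simp [radial_zero, h0]
  · have : ‖p‖ ≠ 0 := norm_ne_zero_iff.2 hp
    rw [radial, norm_smul, norm_div, norm_norm, div_mul_cancel₀ _ this, Real.norm_eq_abs,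
      abs_of_nonneg (hg _ (norm_nonneg p))]

theorem radial_radial {g k : ℝ → ℝ} (hg : g 0 = 0) (h0 : k 0 = 0) (hk : ∀ r, 0 ≤ r → 0 ≤ k r)
    (p : E) :
    radial g (radial k p) = radial (g ∘ k) p := by
  rcases eq_or_ne p 0 with rfl | hp
  · simp [radial_zero]
  · rw [radial, norm_radial h0 hk, radial, radial, smul_smul]
    rcases eq_or_ne (k ‖p‖) 0 with h | h
    · simp [h, hg]
    · congr 1
      simp only [Function.comp]
      field_simp

theorem inner_radial_self (g : ℝ → ℝ) (p : E) : inner ℝ (radial g p) p = g ‖p‖ * ‖p‖ := by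
  rcases eq_or_ne p 0 with rfl | hp
  · simp
  · have : ‖p‖ ≠ 0 := norm_ne_zero_iff.2 hp
    rw [radial, real_inner_smul_left, real_inner_self_eq_norm_sq]
    field_simp

theorem inner_radial_le {g : ℝ → ℝ} (h0 : g 0 = 0) (hg : ∀ r, 0 ≤ r → 0 ≤ g r) (p w : E) :
    inner ℝ (radial g p) w ≤ g ‖p‖ * ‖w‖ := by
  have := real_inner_le_norm (radial g p) w
  rwa [norm_radial h0 hg] at this

theorem radial_add (g k : ℝ → ℝ) (p : E) :
    radial (fun s => g s + k s) p = radial g p + radial k p := by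
  simp [radial, add_div, add_smul]

theorem radial_id (p : E) : radial (fun s => s) p = p := by
  rcases eq_or_ne p 0 with rfl | hp
  · simp [radial]
  · rw [radial, div_self (norm_ne_zero_iff.2 hp), one_smul]

theorem continuous_radial {g : ℝ → ℝ} (h0 : g 0 = 0) (hg : ContinuousOn g (Ici 0)) :
    Continuous (radial g : E → E) := by
  have hgn : Continuous fun p : E => g ‖p‖ :=
    hg.comp_continuous continuous_norm fun p => norm_nonneg p
  rw [continuous_iff_continuousAt]
  intro p
  rcases eq_or_ne p 0 with rfl | hp
  · rw [ContinuousAt, radial_zero, tendsto_zero_iff_norm_tendsto_zero]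
    have h1 : Tendsto (fun p : E => |g ‖p‖|) (𝓝 0) (𝓝 0) := by
      have := (hgn.abs).tendsto (0 : E)
      simpa [h0] using this
    refine squeeze_zero (fun _ => norm_nonneg _) (fun p => ?_) h1
    rw [radial, norm_smul, norm_div, norm_norm, Real.norm_eq_abs]
    rcases eq_or_ne p 0 with rfl | hp
    · simp
    · rw [div_mul_cancel₀ _ (norm_ne_zero_iff.2 hp)]
  · exact (hgn.continuousAt.div continuous_norm.continuousAt (norm_ne_zero_iff.2 hp)).smul
      continuousAt_id

/-- The gradient of a radial function. -/
theorem hasGradientAt_comp_norm [CompleteSpace E] {θ : ℝ → ℝ} (hd : Differentiable ℝ θ)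
    (h0 : deriv θ 0 = 0) (q : E) :
    HasGradientAt (fun q : E => θ ‖q‖) (radial (deriv θ) q) q := by
  rcases eq_or_ne q 0 with rfl | hq
  · rw [radial_zero, hasGradientAt_iff_isLittleO]
    have h1 := (hd 0).hasDerivAt.isLittleO
    rw [h0] at h1
    have h2 := h1.comp_tendsto (k := fun q : E => ‖q‖) (l' := 𝓝 0) (by
      simpa using (continuous_norm (E := E)).tendsto 0)
    rw [← Asymptotics.isLittleO_norm_right] at h2 ⊢
    simpa [Function.comp_def] using h2
  · have h1 : HasFDerivAt (fun q : E => ‖q‖) (‖q‖⁻¹ • innerSL ℝ q) q := by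
      have h := ((hasStrictFDerivAt_norm_sq q).hasFDerivAt).sqrt (by positivity)
      simp only [Real.sqrt_sq (norm_nonneg _)] at h
      convert h using 1
      ext w
      simp
      field_simp
    have h2 := (hd ‖q‖).hasDerivAt.comp_hasFDerivAt q h1
    rw [hasGradientAt_iff_hasFDerivAt]
    have e : InnerProductSpace.toDual ℝ E (radial (deriv θ) q)
        = deriv θ ‖q‖ • (‖q‖⁻¹ • innerSL ℝ q) := by
      ext w
      simp [radial]
      ring
    rw [e]
    exact h2

theorem contDiff_comp_norm [CompleteSpace E] {θ : ℝ → ℝ} (hd : Differentiable ℝ θ)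
    (h0 : deriv θ 0 = 0) (hc : ContinuousOn (deriv θ) (Ici 0)) :
    ContDiff ℝ 1 (fun q : E => θ ‖q‖) := by
  rw [contDiff_one_iff_hasFDerivAt]
  exact ⟨fun q => InnerProductSpace.toDual ℝ E (radial (deriv θ) q),
    (InnerProductSpace.toDual ℝ E).continuous.comp (continuous_radial h0 hc),
    fun q => (hasGradientAt_comp_norm hd h0 q).hasFDerivAt⟩

variable {θ : ℝ → ℝ}

/-- Tangent inequality for the Lagrangian `q ↦ θ ‖q‖`. -/
theorem IsConvexCost.radial_tangent (hθ : IsConvexCost θ) (hd : Differentiable ℝ θ) (q q' : E) :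
    θ ‖q‖ + inner ℝ (radial (deriv θ) q) (q' - q) ≤ θ ‖q'‖ := by
  have h1 := hθ.tangent hd ‖q‖ ‖q'‖
  have h2 := inner_radial_le hθ.deriv_zero (fun r hr => hθ.deriv_nonneg hd hr) q q'
  rw [inner_sub_right, inner_radial_self]
  linarith

/-- Strictness has two sources: for equal norms the strict convexity of Euclidean balls, for
different norms that of `θ`. -/
theorem IsConvexCost.strictConvexOn_comp_norm (hθ : IsConvexCost θ) (hd : Differentiable ℝ θ)
    (hs : StrictConvexOn ℝ univ θ) : StrictConvexOn ℝ univ (fun q : E => θ ‖q‖) := by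
  refine ⟨convex_univ, fun q _ q' _ hne a b ha hb hab => ?_⟩
  have hle : ‖a • q + b • q'‖ ≤ a * ‖q‖ + b * ‖q'‖ := by
    refine (norm_add_le _ _).trans (le_of_eq ?_)
    rw [norm_smul, norm_smul, Real.norm_of_nonneg ha.le, Real.norm_of_nonneg hb.le]
  simp only [smul_eq_mul]
  by_cases hn : ‖q‖ = ‖q'‖
  · have h1 : ‖a • q + b • q'‖ < ‖q‖ := by
      have := norm_combo_lt_of_ne (r := ‖q‖) le_rfl hn.ge hne ha hb hab
      exact this
    have h2 := hθ.strict_mono hs (norm_nonneg _) h1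
    rw [← hn, ← add_mul, hab, one_mul]
    exact h2
  · have h1 := hs.2 (mem_univ ‖q‖) (mem_univ ‖q'‖) hn ha hb hab
    exact (hθ.mono hd (norm_nonneg _) hle).trans_lt h1

end Radial

/-! ### Comparison, and the upper bound by the action of segments. -/

section

variable {n : ℕ} {θ : ℝ → ℝ} {f : EuclideanSpace ℝ (Fin n) → ℝ}
  {v : EuclideanSpace ℝ (Fin n) → ℝ → ℝ}

theorem hjOperator_eq {φ : EuclideanSpace ℝ (Fin n) → ℝ → ℝ} {x g : EuclideanSpace ℝ (Fin n)}
    {t d : ℝ} (hd : HasDerivAt (fun s => φ x s) d t) (hg : HasGradientAt (fun y => φ y t) g x) :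
    hjOperator θ φ x t = d + conjugate θ ‖g‖ := by
  rw [hjOperator, hd.deriv, hg.gradient]

/-- Comparison with a strict supersolution on a compact set. -/
theorem IsViscositySolution.le_of_strict_supersolution (hv : IsViscositySolution θ f v)
    {K : Set (EuclideanSpace ℝ (Fin n) × ℝ)} (hK : IsCompact K) (hK0 : K ⊆ univ ×ˢ Ici 0)
    {φ : EuclideanSpace ℝ (Fin n) → ℝ → ℝ}
    (hφ : ContDiff ℝ 1 (fun p : EuclideanSpace ℝ (Fin n) × ℝ => φ p.1 p.2))
    (h : ∀ p ∈ K, v p.1 p.2 ≤ φ p.1 p.2 ∨ (K ∈ 𝓝 p ∧ 0 < p.2 ∧ 0 < hjOperator θ φ p.1 p.2))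
    {p : EuclideanSpace ℝ (Fin n) × ℝ} (hp : p ∈ K) : v p.1 p.2 ≤ φ p.1 p.2 := by
  obtain ⟨m, hm, hmax⟩ := hK.exists_isMaxOn ⟨p, hp⟩
    ((hv.continuousOn.mono hK0).sub hφ.continuous.continuousOn)
  have hpm : v p.1 p.2 - φ p.1 p.2 ≤ v m.1 m.2 - φ m.1 m.2 := hmax hp
  rcases h m hm with h1 | ⟨h1, h2, h3⟩
  · linarith
  · have := hv.subsolution φ hφ m.1 m.2 h2 (hmax.isLocalMax h1)
    linarith

/-- Comparison with a strict subsolution on a compact set. -/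
theorem IsViscositySolution.ge_of_strict_subsolution (hv : IsViscositySolution θ f v)
    {K : Set (EuclideanSpace ℝ (Fin n) × ℝ)} (hK : IsCompact K) (hK0 : K ⊆ univ ×ˢ Ici 0)
    {φ : EuclideanSpace ℝ (Fin n) → ℝ → ℝ}
    (hφ : ContDiff ℝ 1 (fun p : EuclideanSpace ℝ (Fin n) × ℝ => φ p.1 p.2))
    (h : ∀ p ∈ K, φ p.1 p.2 ≤ v p.1 p.2 ∨ (K ∈ 𝓝 p ∧ 0 < p.2 ∧ hjOperator θ φ p.1 p.2 < 0))
    {p : EuclideanSpace ℝ (Fin n) × ℝ} (hp : p ∈ K) : φ p.1 p.2 ≤ v p.1 p.2 := by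
  obtain ⟨m, hm, hmin⟩ := hK.exists_isMinOn ⟨p, hp⟩
    ((hv.continuousOn.mono hK0).sub hφ.continuous.continuousOn)
  have hpm : v m.1 m.2 - φ m.1 m.2 ≤ v p.1 p.2 - φ p.1 p.2 := hmin hp
  rcases h m hm with h1 | ⟨h1, h2, h3⟩
  · linarith
  · have := hv.supersolution φ hφ m.1 m.2 h2 (hmin.isLocalMin h1)
    linarith

theorem hasGradientAt_const_mul_norm_sub_sq {E : Type*} [NormedAddCommGroup E]
    [InnerProductSpace ℝ E] [CompleteSpace E] (k c : ℝ) (a x : E) :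
    HasGradientAt (fun y => c + k * ‖y - a‖ ^ 2) ((2 * k) • (x - a)) x := by
  have h := (((hasFDerivAt_id x).sub_const a).norm_sq.const_mul k).const_add c
  rw [hasGradientAt_iff_hasFDerivAt]
  refine h.congr_fderiv ?_
  ext w
  simp
  ring

/-- A viscosity subsolution is dominated by the action of straight lines. -/
theorem IsViscositySolution.le_add_action (hv : IsViscositySolution θ f v) (hθ : IsConvexCost θ)
    (hd : Differentiable ℝ θ) (hsup : Superlinear θ) (y q : EuclideanSpace ℝ (Fin n))
    {s t : ℝ} (hs : 0 ≤ s) (hst : s ≤ t) :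
    v (y + (t - s) • q) t ≤ v y s + (t - s) * θ ‖q‖ := by
  -- A tube of radius `1` around the line. It runs past `t`, up to `t + 2`, so that its top can be
  -- guarded by a penalty that is small at time `t`.
  set tube : Set (EuclideanSpace ℝ (Fin n) × ℝ) :=
    (fun p : EuclideanSpace ℝ (Fin n) × ℝ => (y + (p.2 - s) • q + p.1, p.2)) ''
      (Metric.closedBall 0 1 ×ˢ Icc s (t + 2)) with htube
  have hmem : ∀ p, p ∈ tube ↔ ‖p.1 - y - (p.2 - s) • q‖ ≤ 1 ∧ s ≤ p.2 ∧ p.2 ≤ t + 2 := by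
    rintro ⟨x, r⟩
    constructor
    · rintro ⟨⟨z, r'⟩, ⟨hz, hr'⟩, h⟩
      simp only [Prod.mk.injEq] at h
      obtain ⟨rfl, rfl⟩ := h
      refine ⟨?_, hr'⟩
      have : y + (r' - s) • q + z - y - (r' - s) • q = z := by abel
      simpa [this] using hz
    · rintro ⟨h1, h2⟩
      refine ⟨(x - y - (r - s) • q, r), ⟨by simpa using h1, h2⟩, ?_⟩
      simp only [Prod.mk.injEq, and_true]
      abel
  have hK : IsCompact tube :=
    ((isCompact_closedBall _ _).prod isCompact_Icc).image (by fun_prop)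
  have hK0 : tube ⊆ univ ×ˢ Ici 0 := fun p hp => ⟨mem_univ _, hs.trans ((hmem p).1 hp).2.1⟩
  obtain ⟨M, hM⟩ := (hK.image_of_continuousOn (hv.continuousOn.mono hK0)).isBounded.exists_norm_le
  have hM' : ∀ p ∈ tube, |v p.1 p.2| ≤ M := fun p hp => hM _ ⟨p, hp, rfl⟩
  have hy : (y, s) ∈ tube := (hmem _).2 (by simp; linarith)
  have hM0 : 0 ≤ M := (abs_nonneg _).trans (hM' _ hy)
  refine le_of_forall_pos_le_add fun ε₀ hε₀ => ?_
  obtain ⟨ε, hε, hεε⟩ : ∃ ε > 0, ε + ε * (t - s) + ε ≤ ε₀ := by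
    refine ⟨ε₀ / (2 + (t - s)), by apply div_pos hε₀; linarith, ?_⟩
    have : 2 + (t - s) ≠ 0 := by linarith
    apply le_of_eq
    field_simp
    ring
  have hcont : ContinuousWithinAt (fun p : EuclideanSpace ℝ (Fin n) × ℝ => v p.1 p.2)
    (univ ×ˢ Ici 0) (y, s) := hv.continuousOn _ (hK0 hy)
  obtain ⟨r₀, hr₀, hball⟩ := Metric.continuousWithinAt_iff.1 hcont ε hε
  -- The penalty `exp (N (r - t - 1))` is at least `2M` at the top `r = t + 2` and at most `ε` at `r
  -- = t`. The constant `k` below makes the quadratic term reach `2M` on the lateral boundary, and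
  -- on the bottom outside the ball of radius `r₀` where continuity does not help.
  obtain ⟨N, hN0, hN1, hN2⟩ : ∃ N : ℝ, 0 ≤ N ∧ 2 * M ≤ Real.exp N ∧ Real.exp (-N) ≤ ε := by
    have e1 := Real.tendsto_exp_atTop.eventually_ge_atTop (2 * M)
    have e2 := (Real.tendsto_exp_neg_atTop_nhds_zero).eventually_le_const hε
    exact ((eventually_ge_atTop 0).and (e1.and e2)).exists
  set k := 2 * M + 2 * M / r₀ ^ 2 with hk
  have hk1 : 2 * M ≤ k := by have : 0 ≤ 2 * M / r₀ ^ 2 := by positivity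
                             linarith
  have hk2 : 2 * M ≤ k * r₀ ^ 2 := by
    rw [hk, add_mul, div_mul_cancel₀ _ (by positivity)]
    have : 0 ≤ 2 * M * r₀ ^ 2 := by positivity
    linarith
  have hk0 : 0 ≤ k := by linarith
  set φ : EuclideanSpace ℝ (Fin n) → ℝ → ℝ := fun x r =>
    (v y s + ε + (θ ‖q‖ + ε) * (r - s) + Real.exp (N * (r - t - 1)))
      + k * ‖x - (y + (r - s) • q)‖ ^ 2 with hφ
  have hφ1 : ContDiff ℝ 1 (fun p : EuclideanSpace ℝ (Fin n) × ℝ => φ p.1 p.2) := by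
    simp only [hφ]
    refine ContDiff.add (by fun_prop) (contDiff_const.mul (ContDiff.norm_sq ℝ (by fun_prop)))
  -- The transport term `-2k ⟨z, q⟩` is absorbed by Fenchel's inequality `θ*(2k‖z‖) ≥ 2k‖z‖‖q‖ -
  -- θ(‖q‖)`; the slope `ε` leaves strict positivity.
  have hop : ∀ x r, 0 < hjOperator θ φ x r := by
    intro x r
    set z := x - (y + (r - s) • q) with hz
    have hg : HasGradientAt (fun x => φ x r) ((2 * k) • z) x :=
      hasGradientAt_const_mul_norm_sub_sq _ _ _ _
    have hdt : HasDerivAt (fun r => φ x r)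
        ((θ ‖q‖ + ε) + Real.exp (N * (r - t - 1)) * N + k * (2 * inner ℝ z (-q))) r := by
      have h1 : HasDerivAt (fun r => x - (y + (r - s) • q)) (-q) r := by
        have := ((((hasDerivAt_id r).sub_const s).smul_const q).const_add y).const_sub x
        simpa using this
      have h2 := (h1.norm_sq).const_mul k
      have h3 : HasDerivAt (fun r => Real.exp (N * (r - t - 1)))
          (Real.exp (N * (r - t - 1)) * N) r := by
        have := ((((hasDerivAt_id r).sub_const t).sub_const 1).const_mul N).exp
        simpa using this
      have h4 : HasDerivAt (fun r => v y s + ε + (θ ‖q‖ + ε) * (r - s)) (θ ‖q‖ + ε) r := by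
        have := (((hasDerivAt_id r).sub_const s).const_mul (θ ‖q‖ + ε)).const_add (v y s + ε)
        rwa [mul_one] at this
      exact (h4.add h3).add h2
    rw [hjOperator_eq hdt hg]
    have h5 := hθ.le_conjugate hd hsup (norm_nonneg ((2 * k) • z)) ‖q‖
    have h6 := real_inner_le_norm ((2 * k) • z) q
    rw [real_inner_smul_left] at h6
    rw [inner_neg_right]
    have h7 := mul_nonneg (Real.exp_pos (N * (r - t - 1))).le hN0
    linarith
  have hpt : (y + (t - s) • q, t) ∈ tube := (hmem _).2 (by simp; linarith)
  have key := hv.le_of_strict_supersolution hK hK0 hφ1 (fun p hp => ?_) hpt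
  · have e : N * (0 - 1) = -N := by ring
    simp only [hφ, sub_self, norm_zero, e] at key
    linarith
  obtain ⟨h1, h2, h3⟩ := (hmem p).1 hp
  have hv1 := abs_le.1 (hM' p hp)
  have hv2 := abs_le.1 (hM' _ hy)
  have hθ0 := mul_nonneg (add_nonneg (hθ.nonneg ‖q‖) hε.le) (sub_nonneg.2 h2)
  have hE := (Real.exp_pos (N * (p.2 - t - 1))).le
  have hzz : p.1 - (y + (p.2 - s) • q) = p.1 - y - (p.2 - s) • q := by abel
  simp only [hφ, hzz]
  set z := p.1 - y - (p.2 - s) • q with hz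
  have hkz : 0 ≤ k * ‖z‖ ^ 2 := by positivity
  rcases h1.eq_or_lt with h1 | h1
  · left
    rw [h1]
    linarith
  rcases h2.eq_or_lt with h2 | h2
  · left
    rcases lt_or_ge ‖z‖ r₀ with h | h
    · have := hball (x := p) (hK0 hp) (by
        rw [← h2] at hz
        rw [Prod.dist_eq, ← h2, dist_self, dist_eq_norm]
        simp only [sub_self, zero_smul, sub_zero] at hz
        rw [← hz]
        exact max_lt h hr₀)
      rw [Real.dist_eq] at this
      have := (abs_lt.1 this).2
      linarith
    · have : k * r₀ ^ 2 ≤ k * ‖z‖ ^ 2 := by gcongr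
      linarith
  rcases h3.eq_or_lt with h3 | h3
  · left
    have e : N * (p.2 - t - 1) = N := by rw [h3]; ring
    rw [e]
    linarith
  · right
    refine ⟨?_, by linarith, hop _ _⟩
    have hopen : IsOpen {p : EuclideanSpace ℝ (Fin n) × ℝ |
        ‖p.1 - y - (p.2 - s) • q‖ < 1 ∧ s < p.2 ∧ p.2 < t + 2} := by
      refine (isOpen_lt (f := fun p : EuclideanSpace ℝ (Fin n) × ℝ =>
        ‖p.1 - y - (p.2 - s) • q‖) (by fun_prop) continuous_const).inter
        ((isOpen_lt continuous_const continuous_snd).inter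
          (isOpen_lt continuous_snd continuous_const))
    filter_upwards [hopen.mem_nhds ⟨h1, h2, h3⟩] with p' hp'
    exact (hmem p').2 ⟨hp'.1.le, hp'.2.1.le, hp'.2.2.le⟩

end

/-! ### The lower bound: segments along which a supersolution pays the action. -/

section

variable {n : ℕ} {θ : ℝ → ℝ} {f : EuclideanSpace ℝ (Fin n) → ℝ}
  {v : EuclideanSpace ℝ (Fin n) → ℝ → ℝ}

/-- A smooth positive function which agrees with `s ↦ T - s` for `s ≤ a`, where `a < T`. -/
theorem exists_contDiff_pos_eq_sub {a T : ℝ} (haT : a < T) :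
    ∃ ρ : ℝ → ℝ, ContDiff ℝ 1 ρ ∧ (∀ s, 0 < ρ s) ∧ ∀ s ≤ a, ρ s = T - s := by
  -- The cutoff reaches `1` at the midpoint of `[a, T]`, before `T - s` ceases to be positive.
  set χ : ℝ → ℝ := fun s => Real.smoothTransition ((s - a) * (2 / (T - a))) with hχ
  have hT : 0 < T - a := sub_pos.2 haT
  refine ⟨fun s => (T - s) + χ s * (1 - (T - s)), ?_, fun s => ?_, fun s hs => ?_⟩
  · have : ContDiff ℝ 1 χ := Real.smoothTransition.contDiff.comp (by fun_prop)
    fun_prop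
  · have h0 : 0 ≤ χ s := Real.smoothTransition.nonneg _
    have h1 : χ s ≤ 1 := Real.smoothTransition.le_one _
    rcases le_or_gt T s with h | h
    · have : χ s = 1 := Real.smoothTransition.one_of_one_le (by
        rw [mul_div_assoc', le_div_iff₀ hT]
        linarith)
      simp only [this]
      linarith
    · rcases h0.eq_or_lt with h0 | h0
      · simp only [← h0]
        linarith
      · have := mul_nonneg (sub_nonneg.2 h1) (sub_pos.2 h).le
        linarith
  · have : χ s = 0 := Real.smoothTransition.zero_of_nonpos
      (mul_nonpos_of_nonpos_of_nonneg (by linarith) (by positivity))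
    simp [this]

section Perspective

variable {E : Type*} [NormedAddCommGroup E] [InnerProductSpace ℝ E] [CompleteSpace E]

theorem hasDerivAt_perspective (hd : Differentiable ℝ θ) (h0 : deriv θ 0 = 0) {ρ : ℝ → ℝ}
    {ρ' s : ℝ} (hρ : HasDerivAt ρ ρ' s) (hpos : 0 < ρ s) (w : E) :
    HasDerivAt (fun s => ρ s * θ ‖(ρ s)⁻¹ • w‖)
      (ρ' * (θ ‖(ρ s)⁻¹ • w‖ - deriv θ ‖(ρ s)⁻¹ • w‖ * ‖(ρ s)⁻¹ • w‖)) s := by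
  have h1 : HasDerivAt (fun s => (ρ s)⁻¹ • w) ((-ρ' / ρ s ^ 2) • w) s :=
    (hρ.inv hpos.ne').smul_const w
  have h2 := (hasGradientAt_comp_norm hd h0 ((ρ s)⁻¹ • w)).hasFDerivAt.comp_hasDerivAt s h1
  refine (hρ.mul h2).congr_deriv ?_
  have h3 : (-ρ' / ρ s ^ 2) • w = (-ρ' / ρ s) • ((ρ s)⁻¹ • w) := by
    rw [smul_smul]
    congr 1
    field_simp
  rw [h3, InnerProductSpace.toDual_apply_apply, real_inner_smul_right, inner_radial_self]
  simp only [Function.comp]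
  field_simp
  ring

theorem hasGradientAt_perspective (hd : Differentiable ℝ θ) (h0 : deriv θ 0 = 0) {τ : ℝ}
    (hτ : 0 < τ) (a y : E) :
    HasGradientAt (fun y => τ * θ ‖τ⁻¹ • (a - y)‖) (-radial (deriv θ) (τ⁻¹ • (a - y))) y := by
  have h1 : HasFDerivAt (fun y => τ⁻¹ • (a - y)) (τ⁻¹ • -(ContinuousLinearMap.id ℝ E)) y :=
    ((hasFDerivAt_id y).const_sub a).const_smul τ⁻¹
  have h2 := ((hasGradientAt_comp_norm hd h0 (τ⁻¹ • (a - y))).hasFDerivAt.comp y h1).const_mul τ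
  rw [hasGradientAt_iff_hasFDerivAt]
  refine h2.congr_fderiv ?_
  ext w
  simp
  field_simp

end Perspective

/-- A viscosity supersolution dominates, up to `h`, the action of some straight line ending in
`(x₀, t₀ + h)` and starting on the parabolic boundary of a unit cylinder around `x₀`. -/
theorem IsViscositySolution.exists_action_le_add (hv : IsViscositySolution θ f v)
    (hθ : IsConvexCost θ) (hd : Differentiable ℝ θ) (hsup : Superlinear θ)
    (x₀ : EuclideanSpace ℝ (Fin n)) {t₀ h : ℝ} (ht₀ : 0 < t₀) (hh : 0 < h) (hh1 : h ≤ 1) :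
    ∃ y s, ‖y - x₀‖ ≤ 1 ∧ 0 ≤ s ∧ s ≤ t₀ + h / 2 ∧ (s = 0 ∨ ‖y - x₀‖ = 1) ∧
      v y s + (t₀ + h - s) * θ ‖(t₀ + h - s)⁻¹ • (x₀ - y)‖ ≤ v x₀ t₀ + h := by
  -- Otherwise the action to `(x₀, t₀ + h)`, as a function of the starting point, gives a strict
  -- subsolution below `v` on the boundary of the cylinder but above `v` at `(x₀, t₀)`. The cylinder
  -- stops at `t₀ + h / 2`, away from the singular time `t₀ + h`.
  by_contra! hcon
  obtain ⟨ρ, hρ, hρ0, hρs⟩ := exists_contDiff_pos_eq_sub (a := t₀ + h / 2) (T := t₀ + h)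
    (by linarith)
  set C : Set (EuclideanSpace ℝ (Fin n) × ℝ) := Metric.closedBall x₀ 1 ×ˢ Icc 0 (t₀ + h / 2)
    with hC
  have hK : IsCompact C := (isCompact_closedBall _ _).prod isCompact_Icc
  have hK0 : C ⊆ univ ×ˢ Ici 0 := fun p hp => ⟨mem_univ _, hp.2.1⟩
  obtain ⟨M, hM⟩ := (hK.image_of_continuousOn (hv.continuousOn.mono hK0)).isBounded.exists_norm_le
  have hM' : ∀ p ∈ C, |v p.1 p.2| ≤ M := fun p hp => hM _ ⟨p, hp, rfl⟩
  have hx₀ : (x₀, t₀) ∈ C := ⟨by simp, ht₀.le, by linarith⟩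
  -- The penalty beats the oscillation of `v` at the top. At `t₀` the penalty and the slope term `ε
  -- t₀` each cost at most `h / 4`, leaving a gap of `h / 2`.
  obtain ⟨N, hN0, hN1, hN2⟩ : ∃ N : ℝ, 0 ≤ N ∧ 2 * M + 1 ≤ Real.exp (N * (h / 4)) ∧
      Real.exp (-(N * (h / 4))) ≤ h / 4 := by
    have e0 : Tendsto (fun N : ℝ => N * (h / 4)) atTop atTop :=
      tendsto_id.atTop_mul_const (by positivity)
    have e1 := (Real.tendsto_exp_atTop.comp e0).eventually_ge_atTop (2 * M + 1)
    have e2 := (Real.tendsto_exp_neg_atTop_nhds_zero.comp e0).eventually_le_const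
      (show 0 < h / 4 by positivity)
    exact ((eventually_ge_atTop 0).and (e1.and e2)).exists
  set ε := h / (4 * t₀) with hε
  have hε0 : 0 < ε := by positivity
  have hεt : ε * t₀ = h / 4 := by rw [hε]; field_simp
  set φ : EuclideanSpace ℝ (Fin n) → ℝ → ℝ := fun y s =>
    (v x₀ t₀ + h - ε * s - Real.exp (N * (s - t₀ - h / 4))) -
      ρ s * θ ‖(ρ s)⁻¹ • (x₀ - y)‖ with hφ
  have hL : ContDiff ℝ 1 fun q : EuclideanSpace ℝ (Fin n) => θ ‖q‖ :=
    contDiff_comp_norm hd hθ.deriv_zero (hθ.continuousOn_deriv hd hsup)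
  have hφ1 : ContDiff ℝ 1 (fun p : EuclideanSpace ℝ (Fin n) × ℝ => φ p.1 p.2) := by
    have hρ1 : ContDiff ℝ 1 fun p : EuclideanSpace ℝ (Fin n) × ℝ => ρ p.2 :=
      hρ.comp contDiff_snd
    simp only [hφ]
    refine ContDiff.sub (by fun_prop) (hρ1.mul (hL.comp ?_))
    exact (hρ1.inv fun p => (hρ0 _).ne').smul (by fun_prop)
  -- The perspective term solves the equation exactly, by Fenchel's equality at `deriv θ ‖q‖`; only
  -- the negative terms from `ε` and the penalty remain.
  have hop : ∀ y s, s < t₀ + h / 2 → hjOperator θ φ y s < 0 := by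
    intro y s hs
    have hρd : HasDerivAt ρ (-1) s := by
      refine (((hasDerivAt_id s).const_sub (t₀ + h))).congr_of_eventuallyEq ?_
      filter_upwards [Iio_mem_nhds hs] with s' hs' using hρs s' (le_of_lt hs')
    set q := (ρ s)⁻¹ • (x₀ - y) with hq
    have hg : HasGradientAt (fun y => φ y s) (radial (deriv θ) q) y := by
      have := (hasGradientAt_perspective hd hθ.deriv_zero (hρ0 s) x₀ y).hasFDerivAt.const_sub
        (v x₀ t₀ + h - ε * s - Real.exp (N * (s - t₀ - h / 4)))
      rw [hasGradientAt_iff_hasFDerivAt]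
      simpa using this
    have hdt : HasDerivAt (fun s => φ y s) (-ε - Real.exp (N * (s - t₀ - h / 4)) * N -
        (-1) * (θ ‖q‖ - deriv θ ‖q‖ * ‖q‖)) s := by
      have h1 := hasDerivAt_perspective hd hθ.deriv_zero hρd (hρ0 s) (x₀ - y)
      have h3 : HasDerivAt (fun s => Real.exp (N * (s - t₀ - h / 4)))
          (Real.exp (N * (s - t₀ - h / 4)) * N) s := by
        have := ((((hasDerivAt_id s).sub_const t₀).sub_const (h / 4)).const_mul N).exp
        simpa using this
      have h4 : HasDerivAt (fun s => v x₀ t₀ + h - ε * s) (-ε) s := by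
        simpa using ((hasDerivAt_id s).const_mul ε).const_sub (v x₀ t₀ + h)
      exact (h4.sub h3).sub h1
    rw [hjOperator_eq hdt hg, norm_radial hθ.deriv_zero fun r hr => hθ.deriv_nonneg hd hr,
      hθ.conjugate_deriv hd]
    have h7 := mul_nonneg (Real.exp_pos (N * (s - t₀ - h / 4))).le hN0
    linarith
  have key := hv.ge_of_strict_subsolution hK hK0 hφ1 (fun p hp => ?_) hx₀
  · have e : N * (t₀ - t₀ - h / 4) = -(N * (h / 4)) := by ring
    simp only [hφ, e] at key
    simp only [sub_self, smul_zero, norm_zero, hθ.zero, mul_zero] at key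
    linarith
  obtain ⟨h1, h2, h3⟩ := hp
  have hv1 := abs_le.1 (hM' p ⟨h1, h2, h3⟩)
  have hv2 := abs_le.1 (hM' _ hx₀)
  have hE := (Real.exp_pos (N * (p.2 - t₀ - h / 4))).le
  have hεs := mul_nonneg hε0.le h2
  have hbd : (p.2 = 0 ∨ ‖p.1 - x₀‖ = 1) → φ p.1 p.2 ≤ v p.1 p.2 := by
    intro hb
    have := hcon p.1 p.2 (by simpa [dist_eq_norm] using h1) h2 h3 hb
    rw [← hρs _ h3] at this
    simp only [hφ]
    linarith
  by_cases hb : p.2 = 0 ∨ ‖p.1 - x₀‖ = 1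
  · exact Or.inl (hbd hb)
  push Not at hb
  rcases h3.eq_or_lt with h3 | h3
  · left
    have e : N * (p.2 - t₀ - h / 4) = N * (h / 4) := by rw [h3]; ring
    have := mul_nonneg (hρ0 p.2).le (hθ.nonneg ‖(ρ p.2)⁻¹ • (x₀ - p.1)‖)
    simp only [hφ, e]
    linarith
  · right
    have h2' : 0 < p.2 := lt_of_le_of_ne h2 (Ne.symm hb.1)
    refine ⟨?_, h2', hop _ _ h3⟩
    refine prod_mem_nhds (Metric.closedBall_mem_nhds_of_mem ?_) (Icc_mem_nhds h2' h3)
    rw [Metric.mem_ball, dist_eq_norm]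
    refine lt_of_le_of_ne ?_ hb.2
    simpa [dist_eq_norm] using h1

/-- A viscosity supersolution dominates the action of some nontrivial straight line. -/
theorem IsViscositySolution.exists_action_le (hv : IsViscositySolution θ f v)
    (hθ : IsConvexCost θ) (hd : Differentiable ℝ θ) (hsup : Superlinear θ)
    (x₀ : EuclideanSpace ℝ (Fin n)) {t₀ : ℝ} (ht₀ : 0 < t₀) :
    ∃ q s, 0 ≤ s ∧ s < t₀ ∧ v (x₀ - (t₀ - s) • q) s + (t₀ - s) * θ ‖q‖ ≤ v x₀ t₀ := by
  set C : Set (EuclideanSpace ℝ (Fin n) × ℝ) := Metric.closedBall x₀ 1 ×ˢ Icc 0 (t₀ + 1)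
    with hC
  have hK : IsCompact C := (isCompact_closedBall _ _).prod isCompact_Icc
  have hK0 : C ⊆ univ ×ˢ Ici 0 := fun p hp => ⟨mem_univ _, hp.2.1⟩
  obtain ⟨M, hM⟩ := (hK.image_of_continuousOn (hv.continuousOn.mono hK0)).isBounded.exists_norm_le
  have hM' : ∀ p ∈ C, |v p.1 p.2| ≤ M := fun p hp => hM _ ⟨p, hp, rfl⟩
  obtain ⟨τ₀, hτ₀, hτ⟩ := hθ.exists_perspective_gt hd hsup (v x₀ t₀ + 1 + M)
  set τ₁ := min τ₀ t₀ with hτ₁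
  have hτ₁0 : 0 < τ₁ := lt_min hτ₀ ht₀
  set h : ℕ → ℝ := fun k => 1 / ((k : ℝ) + 1) with hh
  have hpos : ∀ k, 0 < h k := fun k => by simp only [hh]; positivity
  have hle : ∀ k, h k ≤ 1 := fun k => by
    simp only [hh]
    rw [div_le_one (by positivity)]
    linarith [Nat.cast_nonneg (α := ℝ) k]
  have hlim : Tendsto h atTop (𝓝 0) := tendsto_one_div_add_atTop_nhds_zero_nat
  choose y s hy hs0 hs1 hor hact using fun k =>
    hv.exists_action_le_add hθ hd hsup x₀ ht₀ (hpos k) (hle k)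
  have hmem : ∀ k, (y k, s k) ∈ C := fun k =>
    ⟨by simpa [dist_eq_norm] using hy k, hs0 k, by linarith [hs1 k, hle k, hpos k]⟩
  -- A segment covering unit distance in time less than `τ₀` is too expensive by superlinearity, so
  -- durations stay away from `0` and the limit segment is nontrivial.
  have hτk : ∀ k, τ₁ ≤ t₀ + h k - s k := by
    intro k
    rcases hor k with h0 | h0
    · rw [h0]
      linarith [min_le_right τ₀ t₀, hpos k]
    · by_contra! hlt
      have hτp : 0 < t₀ + h k - s k := by linarith [hs1 k, hpos k]
      have h1 := hτ _ hτp (hlt.trans_le (min_le_left _ _))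
      have h2 := hact k
      rw [norm_smul, norm_sub_rev, h0, mul_one, Real.norm_of_nonneg (inv_pos.2 hτp).le] at h2
      have h3 := abs_le.1 (hM' _ (hmem k))
      linarith [hle k]
  obtain ⟨⟨y', s'⟩, hy's', ψ, hψ, hψlim⟩ := hK.tendsto_subseq hmem
  have hylim : Tendsto (fun k => y (ψ k)) atTop (𝓝 y') := (continuous_fst.tendsto _).comp hψlim
  have hslim : Tendsto (fun k => s (ψ k)) atTop (𝓝 s') := (continuous_snd.tendsto _).comp hψlim
  have hhlim : Tendsto (fun k => h (ψ k)) atTop (𝓝 0) := hlim.comp hψ.tendsto_atTop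
  have hτlim : Tendsto (fun k => t₀ + h (ψ k) - s (ψ k)) atTop (𝓝 (t₀ - s')) := by
    simpa using (hhlim.const_add t₀).sub hslim
  have hτ' : τ₁ ≤ t₀ - s' := ge_of_tendsto' hτlim fun k => hτk _
  have hτ'0 : 0 < t₀ - s' := hτ₁0.trans_le hτ'
  have hvlim : Tendsto (fun k => v (y (ψ k)) (s (ψ k))) atTop (𝓝 (v y' s')) := by
    have h1 : ContinuousWithinAt (fun p : EuclideanSpace ℝ (Fin n) × ℝ => v p.1 p.2) C (y', s') :=
      hv.continuousOn.mono hK0 _ hy's'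
    exact h1.tendsto.comp (tendsto_nhdsWithin_iff.2 ⟨hψlim, Eventually.of_forall fun k => hmem _⟩)
  refine ⟨(t₀ - s')⁻¹ • (x₀ - y'), s', hy's'.2.1, by linarith, ?_⟩
  rw [smul_inv_smul₀ hτ'0.ne', sub_sub_cancel]
  refine le_of_tendsto_of_tendsto' (hvlim.add (hτlim.mul ((hd.continuous.tendsto _).comp
    (((hτlim.inv₀ hτ'0.ne').smul (hylim.const_sub x₀)).norm)))) 
    (g := fun k => v x₀ t₀ + h (ψ k)) ?_ fun k => hact (ψ k)
  simpa using hhlim.const_add (v x₀ t₀)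

end

/-! ### The Hopf–Lax formula for viscosity solutions. -/

section

variable {n : ℕ} {θ : ℝ → ℝ} {f : EuclideanSpace ℝ (Fin n) → ℝ}
  {v : EuclideanSpace ℝ (Fin n) → ℝ → ℝ}

/-- The Hopf–Lax upper bound. -/
theorem IsViscositySolution.le_hopfLax (hv : IsViscositySolution θ f v) (hθ : IsConvexCost θ)
    (hd : Differentiable ℝ θ) (hsup : Superlinear θ) (x y : EuclideanSpace ℝ (Fin n))
    {t : ℝ} (ht : 0 < t) : v x t ≤ f y + t * θ ‖t⁻¹ • (x - y)‖ := by
  have := hv.le_add_action hθ hd hsup y (t⁻¹ • (x - y)) le_rfl ht.le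
  rwa [sub_zero, smul_inv_smul₀ ht.ne', add_sub_cancel, hv.initial] at this

/-- Backward calibrated segments are straight, hence reach the initial time: the Hopf–Lax
infimum is attained and gives the value of any viscosity solution. No growth condition at infinity
is needed. -/
theorem IsViscositySolution.exists_eq_hopfLax (hv : IsViscositySolution θ f v)
    (hθ : IsConvexCost θ) (hs : StrictConvexOn ℝ univ θ) (hd : Differentiable ℝ θ)
    (hsup : Superlinear θ) (x : EuclideanSpace ℝ (Fin n)) {t : ℝ} (ht : 0 < t) :
    ∃ y, v x t = f y + t * θ ‖t⁻¹ • (x - y)‖ := by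
  obtain ⟨q, s₀, hs₀, hs₀t, h₀⟩ := hv.exists_action_le hθ hd hsup x ht
  have hcont : ContinuousOn (fun s => v (x - (t - s) • q) s + (t - s) * θ ‖q‖) (Icc 0 s₀) := by
    refine ContinuousOn.add ?_ (by fun_prop)
    exact hv.continuousOn.comp (f := fun s => (x - (t - s) • q, s)) (by fun_prop)
      fun s hs => ⟨mem_univ _, hs.1⟩
  have hcpt : IsCompact {s ∈ Icc 0 s₀ | v (x - (t - s) • q) s + (t - s) * θ ‖q‖ ≤ v x t} :=
    isCompact_Icc.of_isClosed_subset (hcont.preimage_isClosed_of_isClosed isClosed_Icc isClosed_Iic)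
      fun s hs => hs.1
  -- The earliest time to which the calibrated segment of velocity `q` extends; if positive, a
  -- further segment starts from there.
  obtain ⟨s, ⟨⟨hs0, hss₀⟩, hsact⟩, hmin⟩ := hcpt.exists_isLeast ⟨s₀, ⟨hs₀, le_rfl⟩, h₀⟩
  rcases hs0.eq_or_lt with rfl | hs0
  · refine ⟨x - t • q, le_antisymm (hv.le_hopfLax hθ hd hsup _ _ ht) ?_⟩
    rw [sub_sub_cancel, inv_smul_smul₀ ht.ne', ← hv.initial]
    simpa using hsact
  exfalso
  obtain ⟨q', s', hs', hs's, h'⟩ := hv.exists_action_le hθ hd hsup (x - (t - s) • q) hs0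
  have hτ : 0 < t - s' := by linarith
  by_cases hq : q = q'
  · subst hq
    have e : x - (t - s) • q - (s - s') • q = x - (t - s') • q := by
      rw [sub_sub, ← add_smul]
      congr 2
      ring
    rw [e] at h'
    have : s ≤ s' := hmin ⟨⟨hs', by linarith⟩, by linarith⟩
    linarith
  -- A corner: the chord with the averaged velocity `q''` is strictly cheaper than the two segments
  -- together, against the upper bound by the action.
  · have hsum : (t - s) / (t - s') + (s - s') / (t - s') = 1 := by
      field_simp
      ring
    have hstrict := (hθ.strictConvexOn_comp_norm hd hs).2 (mem_univ q) (mem_univ q') hq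
      (div_pos (by linarith) hτ) (div_pos (by linarith) hτ) hsum
    set q'' := ((t - s) / (t - s')) • q + ((s - s') / (t - s')) • q' with hq''
    have hline := hv.le_add_action hθ hd hsup (x - (t - s) • q - (s - s') • q') q'' hs'
      (t := t) (by linarith)
    have e : x - (t - s) • q - (s - s') • q' + (t - s') • q'' = x := by
      rw [hq'', smul_add, smul_smul, smul_smul, mul_div_cancel₀ _ hτ.ne',
        mul_div_cancel₀ _ hτ.ne']
      abel
    rw [e] at hline
    have h2 := mul_lt_mul_of_pos_left hstrict hτ
    simp only [smul_eq_mul] at h2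
    have e2 : (t - s') * ((t - s) / (t - s') * θ ‖q‖ + (s - s') / (t - s') * θ ‖q'‖)
        = (t - s) * θ ‖q‖ + (s - s') * θ ‖q'‖ := by
      field_simp
    linarith

/-- The minimizer in the Hopf–Lax formula satisfies the first order condition. -/
theorem IsViscositySolution.exists_characteristic (hv : IsViscositySolution θ f v)
    (hθ : IsConvexCost θ) (hs : StrictConvexOn ℝ univ θ) (hd : Differentiable ℝ θ)
    (hsup : Superlinear θ) (hf : Differentiable ℝ f) (x : EuclideanSpace ℝ (Fin n)) {t : ℝ}
    (ht : 0 < t) : ∃ y, v x t = f y + t * θ ‖t⁻¹ • (x - y)‖ ∧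
      gradient f y = radial (deriv θ) (t⁻¹ • (x - y)) := by
  obtain ⟨y, hy⟩ := hv.exists_eq_hopfLax hθ hs hd hsup x ht
  refine ⟨y, hy, ?_⟩
  have hmin : IsLocalMin (fun z => f z + t * θ ‖t⁻¹ • (x - z)‖) y :=
    Eventually.of_forall fun z => by
      simp only [← hy]
      exact hv.le_hopfLax hθ hd hsup x z ht
  have h0 := hmin.hasFDerivAt_eq_zero ((hf y).hasGradientAt.hasFDerivAt.add
    (hasGradientAt_perspective hd hθ.deriv_zero ht x y).hasFDerivAt)
  rw [← map_add, LinearIsometryEquiv.map_eq_zero_iff, ← sub_eq_add_neg, sub_eq_zero] at h0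
  exact h0

end

/-! ### Differential calculus of radial maps. -/

section RadialDeriv

variable {E : Type*} [NormedAddCommGroup E] [InnerProductSpace ℝ E]

theorem radial_eq_dslope {g : ℝ → ℝ} (h0 : g 0 = 0) (p : E) :
    radial g p = dslope g 0 ‖p‖ • p := by
  rcases eq_or_ne p 0 with rfl | hp
  · simp [radial_zero]
  · rw [radial, dslope_of_ne _ (norm_ne_zero_iff.2 hp), slope_def_field, h0, sub_zero, sub_zero]

/-- The derivative of `radial g`. -/
def radialDeriv (g : ℝ → ℝ) (p : E) : E →L[ℝ] E :=
  dslope g 0 ‖p‖ • ContinuousLinearMap.id ℝ E +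
    ((deriv g ‖p‖ - dslope g 0 ‖p‖) / ‖p‖ ^ 2) • (innerSL ℝ p).smulRight p

theorem radialDeriv_apply (g : ℝ → ℝ) (p w : E) :
    radialDeriv g p w = dslope g 0 ‖p‖ • w +
      ((deriv g ‖p‖ - dslope g 0 ‖p‖) / ‖p‖ ^ 2 * inner ℝ p w) • p := by
  simp [radialDeriv, smul_smul]

theorem hasFDerivAt_radial {g : ℝ → ℝ} (hg : Differentiable ℝ g) (h0 : g 0 = 0) (p : E) :
    HasFDerivAt (radial g : E → E) (radialDeriv g p) p := by
  rcases eq_or_ne p 0 with rfl | hp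
  · rw [hasFDerivAt_iff_isLittleO_nhds_zero]
    have h1 : Tendsto (fun w : E => dslope g 0 ‖w‖ - dslope g 0 0) (𝓝 0) (𝓝 0) := by
      have := ((continuousAt_dslope_same.2 (hg 0)).tendsto.comp
        (by simpa using (continuous_norm (E := E)).tendsto 0)).sub_const (dslope g 0 0)
      simpa using this
    have h2 : (fun w : E => (dslope g 0 ‖w‖ - dslope g 0 0) • w) =o[𝓝 0] fun w => w := by
      have := ((Asymptotics.isLittleO_one_iff ℝ).2 h1).smul_isBigO
        (Asymptotics.isBigO_refl (fun w : E => w) (𝓝 0))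
      simpa using this
    refine h2.congr_left fun w => ?_
    rw [zero_add, radial_zero, radial_eq_dslope h0, radialDeriv_apply]
    simp [sub_smul]
  · have hr : ‖p‖ ≠ 0 := norm_ne_zero_iff.2 hp
    have h1 : HasFDerivAt (fun q : E => ‖q‖) (‖p‖⁻¹ • innerSL ℝ p) p := by
      have h := (hasStrictFDerivAt_norm_sq p).hasFDerivAt.sqrt (by positivity)
      simp only [Real.sqrt_sq (norm_nonneg _)] at h
      refine h.congr_fderiv ?_
      ext w
      simp
      field_simp
    have h2 : HasDerivAt (fun r => g r / r) ((deriv g ‖p‖ * ‖p‖ - g ‖p‖ * 1) / ‖p‖ ^ 2) ‖p‖ :=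
      (hg ‖p‖).hasDerivAt.div (hasDerivAt_id _) hr
    have h3 := (h2.comp_hasFDerivAt p h1).smul (hasFDerivAt_id p)
    refine h3.congr_fderiv ?_
    ext w
    rw [radialDeriv_apply, dslope_of_ne _ hr, slope_def_field, h0, sub_zero, sub_zero]
    simp only [add_apply, smul_apply, ContinuousLinearMap.smulRight_apply,
      ContinuousLinearMap.id_apply, innerSL_apply_apply, smul_eq_mul, Function.comp, id]
    congr 2
    field_simp

theorem continuous_radialDeriv {g : ℝ → ℝ} (hg : ContDiff ℝ 1 g) :
    Continuous (radialDeriv g : E → E →L[ℝ] E) := by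
  have hgd := hg.differentiable one_ne_zero
  have hs : Continuous (dslope g 0) := by
    rw [continuous_iff_continuousAt]
    intro r
    rcases eq_or_ne r 0 with rfl | hr
    · exact continuousAt_dslope_same.2 (hgd 0)
    · exact (continuousAt_dslope_of_ne hr).2 (hgd r).continuousAt
  have hs' : Continuous fun p : E => dslope g 0 ‖p‖ := hs.comp continuous_norm
  have hd' : Continuous fun p : E => deriv g ‖p‖ :=
    (hg.continuous_deriv le_rfl).comp continuous_norm
  have hK : Continuous fun p : E => (innerSL ℝ p).smulRight p := by fun_prop
  refine (hs'.smul continuous_const).add ?_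
  rw [continuous_iff_continuousAt]
  intro p
  rcases eq_or_ne p 0 with rfl | hp
  · rw [ContinuousAt]
    simp only [map_zero, norm_zero, ContinuousLinearMap.smulRight_zero, smul_zero]
    rw [tendsto_zero_iff_norm_tendsto_zero]
    have h1 : Tendsto (fun p : E => |deriv g ‖p‖ - dslope g 0 ‖p‖|) (𝓝 0) (𝓝 0) := by
      have := ((hd'.sub hs').abs).tendsto (0 : E)
      simpa using this
    refine squeeze_zero (fun _ => norm_nonneg _) (fun p => ?_) h1
    rw [norm_smul, ContinuousLinearMap.norm_smulRight_apply, innerSL_apply_norm, norm_div,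
      Real.norm_eq_abs, norm_pow, norm_norm, ← sq]
    rcases eq_or_ne p 0 with rfl | hp
    · simp
    · rw [div_mul_cancel₀]
      exact pow_ne_zero _ (norm_ne_zero_iff.2 hp)
  · exact ((hd'.sub hs').continuousAt.div (continuous_norm.pow 2).continuousAt
      (pow_ne_zero _ (norm_ne_zero_iff.2 hp))).smul hK.continuousAt

theorem contDiff_radial {g : ℝ → ℝ} (hg : ContDiff ℝ 1 g) (h0 : g 0 = 0) :
    ContDiff ℝ 1 (radial g : E → E) :=
  contDiff_one_iff_hasFDerivAt.2 ⟨_, continuous_radialDeriv hg,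
    hasFDerivAt_radial (hg.differentiable one_ne_zero) h0⟩

theorem inner_radialDeriv (g : ℝ → ℝ) (p u w : E) :
    inner ℝ (radialDeriv g p u) w = dslope g 0 ‖p‖ * inner ℝ u w +
      (deriv g ‖p‖ - dslope g 0 ‖p‖) / ‖p‖ ^ 2 * inner ℝ p u * inner ℝ p w := by
  rw [radialDeriv_apply, inner_add_left, real_inner_smul_left, real_inner_smul_left]

/-- Monotonicity is known only on the half-line, so at `0` the one-sided derivative is used. -/
theorem deriv_nonneg_of_monotoneOn {g : ℝ → ℝ} (hg : Differentiable ℝ g)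
    (hm : MonotoneOn g (Ici 0)) {r : ℝ} (hr : 0 ≤ r) : 0 ≤ deriv g r := by
  rw [← (hg r).derivWithin (uniqueDiffOn_Ici 0 r hr)]
  exact hm.derivWithin_nonneg

/-- If `p` is an eigenvector of a positive semidefinite operator `A`, the quadratic form of
`radialDeriv g p ∘ A` is nonnegative for every `g` which is monotone on `[0, ∞)`. -/
theorem radialDeriv_form_nonneg {g : ℝ → ℝ} (hg : Differentiable ℝ g) (h0 : g 0 = 0)
    (hm : MonotoneOn g (Ici 0)) {A : E →L[ℝ] E} {p : E} {lam : ℝ}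
    (hsymm : ∀ u w, inner ℝ (A u) w = inner ℝ (A w) u) (hpos : ∀ d, 0 ≤ inner ℝ (A d) d)
    (hev : A p = lam • p) (d : E) :
    0 ≤ dslope g 0 ‖p‖ * inner ℝ (A d) d +
      (deriv g ‖p‖ - dslope g 0 ‖p‖) / ‖p‖ ^ 2 * (lam * inner ℝ p d) * inner ℝ p d := by
  have hb := deriv_nonneg_of_monotoneOn hg hm (norm_nonneg p)
  rcases eq_or_ne p 0 with rfl | hp
  · rw [norm_zero] at hb
    simpa using mul_nonneg hb (hpos d)
  · have hr : 0 < ‖p‖ := norm_pos_iff.2 hp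
    have ha : 0 ≤ dslope g 0 ‖p‖ := by
      rw [dslope_of_ne _ hr.ne', slope_def_field, h0, sub_zero, sub_zero]
      exact div_nonneg (h0 ▸ hm self_mem_Ici hr.le hr.le) hr.le
    set a := dslope g 0 ‖p‖
    set b := deriv g ‖p‖
    set c := inner ℝ p d with hc
    have hlam : 0 ≤ lam := by
      have := hpos p
      rw [hev, real_inner_smul_left, real_inner_self_eq_norm_sq] at this
      exact nonneg_of_mul_nonneg_left this (by positivity)
    -- The component of `d` orthogonal to `p`. As `p` is an eigenvector, the form splits into the
    -- slope of `g` times `A` on this component, plus `deriv g ‖p‖` times `lam c² / ‖p‖²`.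
    have h1 := hpos (d - (c / ‖p‖ ^ 2) • p)
    have h2 : inner ℝ (A d) p = lam * c := by
      rw [hsymm, hev, real_inner_smul_left]
    rw [map_sub, map_smul, hev, inner_sub_left, inner_sub_right, inner_sub_right,
      real_inner_smul_left, real_inner_smul_left, real_inner_smul_left, real_inner_smul_left,
      real_inner_smul_right, real_inner_smul_right, h2, real_inner_self_eq_norm_sq, ← hc] at h1
    have h3 : 0 ≤ inner ℝ (A d) d - lam * (c ^ 2 / ‖p‖ ^ 2) := by
      refine h1.trans (le_of_eq ?_)
      field_simp
      ring
    have h4 := mul_nonneg ha h3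
    have h5 := mul_nonneg hb (mul_nonneg hlam (show 0 ≤ c ^ 2 / ‖p‖ ^ 2 by positivity))
    refine (add_nonneg h4 h5).trans (le_of_eq ?_)
    ring

end RadialDeriv

/-! ### Convexity along lines and the Hessian. -/

theorem convexOn_line {E : Type*} [NormedAddCommGroup E] [NormedSpace ℝ E] {f : E → ℝ}
    (hf : ConvexOn ℝ univ f) (x d : E) :
    ConvexOn ℝ univ (fun s : ℝ => f (x + s • d)) := by
  refine ⟨convex_univ, fun s _ s' _ a b ha hb hab => ?_⟩
  have h := hf.2 (mem_univ (x + s • d)) (mem_univ (x + s' • d)) ha hb hab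
  have e : a • (x + s • d) + b • (x + s' • d) = x + (a • s + b • s') • d := by
    have : x = (a + b) • x := by rw [hab, one_smul]
    conv_rhs => rw [this]
    simp only [smul_add, add_smul, smul_smul, smul_eq_mul]
    abel
  rwa [e] at h

theorem convexOn_of_lines {E : Type*} [NormedAddCommGroup E] [NormedSpace ℝ E] {f : E → ℝ}
    (h : ∀ x d : E, ConvexOn ℝ univ (fun s : ℝ => f (x + s • d))) :
    ConvexOn ℝ univ f := by
  refine ⟨convex_univ, fun x _ y _ a b ha hb hab => ?_⟩
  have h1 := (h x (y - x)).2 (mem_univ 0) (mem_univ 1) ha hb hab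
  have e : x + (a • (0 : ℝ) + b • (1 : ℝ)) • (y - x) = a • x + b • y := by
    have : a = 1 - b := by linarith
    subst this
    simp only [smul_eq_mul, mul_zero, mul_one, zero_add, smul_sub, sub_smul, one_smul]
    abel
  simp only [e] at h1
  simpa using h1

section Hessian

variable {E : Type*} [NormedAddCommGroup E] [InnerProductSpace ℝ E] [CompleteSpace E]
  {f : E → ℝ}

theorem contDiff_gradient (hf : ContDiff ℝ 2 f) : ContDiff ℝ 1 (gradient f) :=
  (InnerProductSpace.toDual ℝ E).symm.contDiff.comp (hf.fderiv_right (m := 1) (by norm_num))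

theorem inner_fderiv_gradient (hf : ContDiff ℝ 2 f) (x u w : E) :
    inner ℝ (fderiv ℝ (gradient f) x u) w = fderiv ℝ (fderiv ℝ f) x u w := by
  have h1 := ((contDiff_gradient hf).differentiable one_ne_zero x).hasFDerivAt
  have h2 := (InnerProductSpace.toDual ℝ E).toContinuousLinearEquiv.hasFDerivAt.comp x h1
  have h3 : (InnerProductSpace.toDual ℝ E).toContinuousLinearEquiv ∘ gradient f = fderiv ℝ f :=
    toDual_comp_gradient
  rw [h3] at h2
  rw [h2.fderiv]
  simp

theorem inner_fderiv_gradient_comm (hf : ContDiff ℝ 2 f) (x u w : E) :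
    inner ℝ (fderiv ℝ (gradient f) x u) w = inner ℝ (fderiv ℝ (gradient f) x w) u := by
  rw [inner_fderiv_gradient hf, inner_fderiv_gradient hf]
  exact (hf.contDiffAt.isSymmSndFDerivAt (by simp)) u w

theorem hasDerivAt_line (hf : Differentiable ℝ f) (x d : E) (s : ℝ) :
    HasDerivAt (fun s : ℝ => f (x + s • d)) (inner ℝ (gradient f (x + s • d)) d) s := by
  have h1 : HasDerivAt (fun s : ℝ => x + s • d) d s := by
    simpa using ((hasDerivAt_id s).smul_const d).const_add x
  have h2 := (hf (x + s • d)).hasGradientAt.hasFDerivAt.comp_hasDerivAt s h1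
  rwa [InnerProductSpace.toDual_apply_apply] at h2

theorem hasDerivAt_inner_gradient_line (hf : ContDiff ℝ 2 f) (x d : E) (s : ℝ) :
    HasDerivAt (fun s : ℝ => inner ℝ (gradient f (x + s • d)) d)
      (inner ℝ (fderiv ℝ (gradient f) (x + s • d) d) d) s := by
  have h1 : HasDerivAt (fun s : ℝ => x + s • d) d s := by
    simpa using ((hasDerivAt_id s).smul_const d).const_add x
  have h2 := ((contDiff_gradient hf).differentiable one_ne_zero
    (x + s • d)).hasFDerivAt.comp_hasDerivAt s h1
  simpa using h2.inner ℝ (hasDerivAt_const s d)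

theorem inner_fderiv_gradient_nonneg (hf : ContDiff ℝ 2 f) (hc : ConvexOn ℝ univ f) (x d : E) :
    0 ≤ inner ℝ (fderiv ℝ (gradient f) x d) d := by
  have h1 := hasDerivAt_line (hf.differentiable two_ne_zero) x d
  have h2 : Monotone fun s : ℝ => inner ℝ (gradient f (x + s • d)) d := by
    have := (convexOn_line hc x d).monotoneOn_deriv fun s _ => (h1 s).differentiableAt
    rw [monotoneOn_univ] at this
    convert this using 1
    funext s
    exact (h1 s).deriv.symm
  have h3 := hasDerivAt_inner_gradient_line hf x d 0
  rw [zero_smul, add_zero] at h3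
  rw [← h3.deriv]
  exact h2.deriv_nonneg

theorem convex_tangent (hc : ConvexOn ℝ univ f) (hf : Differentiable ℝ f) (x y : E) :
    f x + inner ℝ (gradient f x) (y - x) ≤ f y := by
  have h1 := hasDerivAt_line hf x (y - x) 0
  have h2 := tangent_le (convexOn_line hc x (y - x)) h1 1
  simpa using h2

end Hessian

/-! ### Radial rescaling of gradients in the class `𝓕`. -/

section ClassF

variable {n : ℕ} {f g : EuclideanSpace ℝ (Fin n) → ℝ} {G : ℝ → ℝ}

/-- Symmetry of the Hessian makes the gradient a left eigenvector too; this is what makes the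
bilinear form of the rescaled Hessian symmetric. -/
theorem ClassF.inner_gradient_fderiv (hf : ClassF f) (x : EuclideanSpace ℝ (Fin n)) :
    ∃ lam : ℝ, fderiv ℝ (gradient f) x (gradient f x) = lam • gradient f x ∧
      ∀ u, inner ℝ (gradient f x) (fderiv ℝ (gradient f) x u) = lam * inner ℝ (gradient f x) u := by
  obtain ⟨lam, h⟩ := hf.eigen x
  refine ⟨lam, h, fun u => ?_⟩
  rw [real_inner_comm, inner_fderiv_gradient_comm hf.contDiff, h, real_inner_smul_left]

/-- A radial rescaling of the gradient of `f ∈ 𝓕` is again a gradient field. -/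
theorem ClassF.exists_potential (hf : ClassF f) (hG : ContDiff ℝ 1 G) (h0 : G 0 = 0) :
    ∃ g : EuclideanSpace ℝ (Fin n) → ℝ, ∀ x, HasGradientAt g (radial G (gradient f x)) x := by
  have hP : ∀ x, HasFDerivAt (fun x => radial G (gradient f x))
      ((radialDeriv G (gradient f x)).comp (fderiv ℝ (gradient f) x)) x := fun x =>
    (hasFDerivAt_radial (hG.differentiable one_ne_zero) h0 _).comp x
      ((contDiff_gradient hf.contDiff).differentiable one_ne_zero x).hasFDerivAt
  set ω : EuclideanSpace ℝ (Fin n) → EuclideanSpace ℝ (Fin n) →L[ℝ] ℝ :=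
    fun x => innerSL ℝ (radial G (gradient f x)) with hω
  have hωd : ∀ x, HasFDerivAt ω ((innerSL ℝ).comp
      ((radialDeriv G (gradient f x)).comp (fderiv ℝ (gradient f) x))) x := fun x =>
    (innerSL ℝ).hasFDerivAt.comp x (hP x)
  -- Poincaré lemma: the one-form is closed because its derivative is symmetric.
  obtain ⟨g, hg⟩ := convex_univ.exists_forall_hasFDerivAt_of_fderiv_symmetric isOpen_univ
    (fun x _ => (hωd x).differentiableAt.differentiableWithinAt) (fun x _ u w => by
      rw [(hωd x).fderiv]
      simp only [ContinuousLinearMap.comp_apply, innerSL_apply_apply]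
      obtain ⟨lam, -, hlam⟩ := hf.inner_gradient_fderiv x
      rw [inner_radialDeriv, inner_radialDeriv, hlam, hlam,
        inner_fderiv_gradient_comm hf.contDiff]
      ring)
  exact ⟨g, fun x => hasGradientAt_iff_hasFDerivAt.2 (hg x (mem_univ x))⟩

/-- A potential of a monotone radial rescaling of the gradient of `f ∈ 𝓕` belongs to `𝓕`. -/
theorem ClassF.of_hasGradientAt (hf : ClassF f) (hG : ContDiff ℝ 1 G) (h0 : G 0 = 0)
    (hm : MonotoneOn G (Ici 0))
    (hg : ∀ x, HasGradientAt g (radial G (gradient f x)) x) : ClassF g := by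
  have hgrad : gradient g = fun x => radial G (gradient f x) := gradient_eq hg
  have hgrad1 : ContDiff ℝ 1 (gradient g) := by
    rw [hgrad]
    exact (contDiff_radial hG h0).comp (contDiff_gradient hf.contDiff)
  have hgd : Differentiable ℝ g := fun x => (hg x).differentiableAt
  have hcd : ContDiff ℝ 2 g := by
    have h2 : ContDiff ℝ (1 + 1) g := by
      refine contDiff_succ_iff_fderiv.2 ⟨hgd, by simp, ?_⟩
      rw [← toDual_comp_gradient]
      exact (InnerProductSpace.toDual ℝ _).contDiff.comp hgrad1
    simpa [one_add_one_eq_two] using h2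
  have hH : ∀ x, fderiv ℝ (gradient g) x =
      (radialDeriv G (gradient f x)).comp (fderiv ℝ (gradient f) x) := fun x => by
    rw [hgrad]
    exact ((hasFDerivAt_radial (hG.differentiable one_ne_zero) h0 _).comp x
      ((contDiff_gradient hf.contDiff).differentiable one_ne_zero x).hasFDerivAt).fderiv
  refine ⟨?_, hcd, fun x => ?_⟩
  · refine convexOn_of_lines fun x d => ?_
    have hmono : Monotone fun s : ℝ => inner ℝ (gradient g (x + s • d)) d := by
      refine monotone_of_hasDerivAt_nonneg (hasDerivAt_inner_gradient_line hcd x d) fun s => ?_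
      generalize x + s • d = z
      obtain ⟨lam, hev, hlam⟩ := hf.inner_gradient_fderiv z
      have hpos := inner_fderiv_gradient_nonneg hf.contDiff hf.convex z
      rw [hH]
      simp only [ContinuousLinearMap.comp_apply, Pi.zero_apply]
      rw [inner_radialDeriv, hlam]
      exact radialDeriv_form_nonneg (hG.differentiable one_ne_zero) h0 hm
        (fun u w => inner_fderiv_gradient_comm hf.contDiff z u w) hpos hev d
    have h1 : deriv (fun s : ℝ => g (x + s • d)) =
        fun s => inner ℝ (gradient g (x + s • d)) d :=
      funext fun s => (hasDerivAt_line hgd x d s).deriv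
    refine Monotone.convexOn_univ_of_deriv
      (fun s => (hasDerivAt_line hgd x d s).differentiableAt) ?_
    rw [h1]
    exact hmono
  · obtain ⟨lam, hev, hlam⟩ := hf.inner_gradient_fderiv x
    refine ⟨lam * (dslope G 0 ‖gradient f x‖ + (deriv G ‖gradient f x‖ -
      dslope G 0 ‖gradient f x‖) / ‖gradient f x‖ ^ 2 * ‖gradient f x‖ ^ 2), ?_⟩
    rw [hH, hgrad]
    simp only [ContinuousLinearMap.comp_apply]
    rw [radial_eq_dslope h0, map_smul, hev, map_smul, map_smul, radialDeriv_apply,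
      real_inner_self_eq_norm_sq, ← add_smul, smul_smul, smul_smul, smul_smul]
    congr 1
    ring

end ClassF

/-! ### Classical solutions from characteristics. -/

section

variable {n : ℕ} {θ : ℝ → ℝ} {f g : EuclideanSpace ℝ (Fin n) → ℝ}
  {v : EuclideanSpace ℝ (Fin n) → ℝ → ℝ}

theorem hjOperator_of_hasFDerivAt {φ : EuclideanSpace ℝ (Fin n) → ℝ → ℝ}
    {D : EuclideanSpace ℝ (Fin n) × ℝ →L[ℝ] ℝ} {x : EuclideanSpace ℝ (Fin n)} {t : ℝ}
    (h : HasFDerivAt (fun p : EuclideanSpace ℝ (Fin n) × ℝ => φ p.1 p.2) D (x, t)) :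
    hjOperator θ φ x t = D (0, 1) + conjugate θ
      ‖(InnerProductSpace.toDual ℝ _).symm (D.comp (ContinuousLinearMap.inl ℝ _ ℝ))‖ := by
  have h1 : HasDerivAt (fun s => φ x s) (D (0, 1)) t :=
    h.comp_hasDerivAt t ((hasDerivAt_const t x).prodMk (hasDerivAt_id t))
  have h2 : HasFDerivAt (fun y => φ y t) (D.comp (ContinuousLinearMap.inl ℝ _ ℝ)) x :=
    HasFDerivAt.comp (f := fun y => (y, t)) x h (hasFDerivAt_prodMk_left x t)
  exact hjOperator_eq h1 (hasFDerivAt_iff_hasGradientAt.1 h2)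

/-- Classical solutions are viscosity solutions. -/
theorem IsClassicalSolution.isViscositySolution (hv : IsClassicalSolution θ f v) :
    IsViscositySolution θ f v := by
  have key : ∀ φ : EuclideanSpace ℝ (Fin n) → ℝ → ℝ,
      ContDiff ℝ 1 (fun p : EuclideanSpace ℝ (Fin n) × ℝ => φ p.1 p.2) →
      ∀ (x : EuclideanSpace ℝ (Fin n)) (t : ℝ), 0 < t →
      IsLocalExtr (fun p : EuclideanSpace ℝ (Fin n) × ℝ => v p.1 p.2 - φ p.1 p.2) (x, t) →
      hjOperator θ φ x t = 0 := by
    intro φ hφ x t ht hext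
    have h1 := (hv.differentiableAt x t ht).hasFDerivAt
    have h2 := (hφ.differentiable one_ne_zero (x, t)).hasFDerivAt
    have h3 := hext.hasFDerivAt_eq_zero (h1.sub h2)
    rw [sub_eq_zero] at h3
    rw [hjOperator_of_hasFDerivAt h2, ← h3, ← hjOperator_of_hasFDerivAt h1]
    exact hv.equation x t ht
  exact ⟨hv.continuousOn, hv.initial,
    fun φ hφ x t ht hmax => (key φ hφ x t ht hmax.isExtr).le,
    fun φ hφ x t ht hmin => (key φ hφ x t ht hmin.isExtr).ge⟩

/-- The function with initial values `g` which transports `g` along the characteristics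
starting at `Y x t`. -/
def characteristicValue (θ : ℝ → ℝ) (g : EuclideanSpace ℝ (Fin n) → ℝ)
    (Y : EuclideanSpace ℝ (Fin n) → ℝ → EuclideanSpace ℝ (Fin n))
    (x : EuclideanSpace ℝ (Fin n)) (t : ℝ) : ℝ :=
  if 0 < t then g (Y x t) + t * θ ‖t⁻¹ • (x - Y x t)‖ else g x

/-- The affine function determined by the first order condition at `y` lies below the
Hopf–Lax functional. -/
theorem affine_le_action (hθ : IsConvexCost θ) (hd : Differentiable ℝ θ)
    (hg : ConvexOn ℝ univ g) (hgd : Differentiable ℝ g) {y q : EuclideanSpace ℝ (Fin n)}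
    (hy : gradient g y = radial (deriv θ) q) (x z : EuclideanSpace ℝ (Fin n)) {t : ℝ}
    (ht : 0 < t) :
    g y + inner ℝ (gradient g y) (x - y) + t * (θ ‖q‖ - deriv θ ‖q‖ * ‖q‖) ≤
      g z + t * θ ‖t⁻¹ • (x - z)‖ := by
  have h1 := convex_tangent hg hgd y z
  have h2 := mul_le_mul_of_nonneg_left (hθ.radial_tangent hd q (t⁻¹ • (x - z))) ht.le
  rw [inner_sub_right, inner_radial_self, real_inner_smul_right, ← hy, mul_add, mul_sub,
    mul_inv_cancel_left₀ ht.ne', inner_sub_right] at h2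
  rw [inner_sub_right] at h1 ⊢
  linarith

theorem characteristicValue_eq_affine
    {Y : EuclideanSpace ℝ (Fin n) → ℝ → EuclideanSpace ℝ (Fin n)}
    (hY : ∀ x t, 0 < t → gradient g (Y x t) = radial (deriv θ) (t⁻¹ • (x - Y x t)))
    (x : EuclideanSpace ℝ (Fin n)) {t : ℝ} (ht : 0 < t) :
    characteristicValue θ g Y x t = g (Y x t) + inner ℝ (gradient g (Y x t)) (x - Y x t) +
      t * (θ ‖t⁻¹ • (x - Y x t)‖ - deriv θ ‖t⁻¹ • (x - Y x t)‖ * ‖t⁻¹ • (x - Y x t)‖) := by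
  have h1 : inner ℝ (gradient g (Y x t)) (x - Y x t) =
      t * (deriv θ ‖t⁻¹ • (x - Y x t)‖ * ‖t⁻¹ • (x - Y x t)‖) := by
    rw [← inner_radial_self, ← real_inner_smul_right, smul_inv_smul₀ ht.ne', hY x t ht]
  rw [h1, characteristicValue, if_pos ht]
  ring

/-- Convexity of `g` and of the Lagrangian makes the critical point `Y x t` a global minimizer of
the action. -/
theorem characteristicValue_le_action
    (hθ : IsConvexCost θ) (hd : Differentiable ℝ θ)
    (hg : ConvexOn ℝ univ g) (hgd : Differentiable ℝ g)
    {Y : EuclideanSpace ℝ (Fin n) → ℝ → EuclideanSpace ℝ (Fin n)}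
    (hY : ∀ x t, 0 < t → gradient g (Y x t) = radial (deriv θ) (t⁻¹ • (x - Y x t)))
    (x z : EuclideanSpace ℝ (Fin n)) {t : ℝ} (ht : 0 < t) :
    characteristicValue θ g Y x t ≤ g z + t * θ ‖t⁻¹ • (x - z)‖ := by
  rw [characteristicValue_eq_affine hY x ht]
  exact affine_le_action hθ hd hg hgd (hY x t ht) x z ht

/-- No regularity of `Y` is needed: freezing `y = Y x t` gives an affine lower bound and a
differentiable upper bound that touch at `(x, t)`. Their difference has a minimum there, so their
derivatives agree. -/
theorem hasFDerivAt_characteristicValue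
    (hθ : IsConvexCost θ) (hd : Differentiable ℝ θ)
    (hg : ConvexOn ℝ univ g) (hgd : Differentiable ℝ g)
    {Y : EuclideanSpace ℝ (Fin n) → ℝ → EuclideanSpace ℝ (Fin n)}
    (hY : ∀ x t, 0 < t → gradient g (Y x t) = radial (deriv θ) (t⁻¹ • (x - Y x t)))
    (x : EuclideanSpace ℝ (Fin n)) {t : ℝ} (ht : 0 < t) :
    HasFDerivAt (fun p : EuclideanSpace ℝ (Fin n) × ℝ => characteristicValue θ g Y p.1 p.2)
      ((innerSL ℝ (gradient g (Y x t))).comp (ContinuousLinearMap.fst ℝ _ ℝ) +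
        (θ ‖t⁻¹ • (x - Y x t)‖ - deriv θ ‖t⁻¹ • (x - Y x t)‖ * ‖t⁻¹ • (x - Y x t)‖) •
          ContinuousLinearMap.snd ℝ _ ℝ) (x, t) := by
  set y := Y x t with hy
  set q := t⁻¹ • (x - y) with hq
  set m := θ ‖q‖ - deriv θ ‖q‖ * ‖q‖ with hm
  set l : EuclideanSpace ℝ (Fin n) × ℝ → ℝ :=
    fun p => g y + inner ℝ (gradient g y) (p.1 - y) + p.2 * m with hl
  set u : EuclideanSpace ℝ (Fin n) × ℝ → ℝ :=
    fun p => g y + p.2 * θ ‖p.2⁻¹ • (p.1 - y)‖ with hu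
  have hpos : ∀ᶠ p : EuclideanSpace ℝ (Fin n) × ℝ in 𝓝 (x, t), 0 < p.2 :=
    continuous_snd.continuousAt.eventually (lt_mem_nhds ht)
  have hlw : ∀ᶠ p in 𝓝 (x, t), l p ≤ characteristicValue θ g Y p.1 p.2 := by
    filter_upwards [hpos] with p hp
    rw [characteristicValue, if_pos hp]
    exact affine_le_action hθ hd hg hgd (hY x t ht) p.1 _ hp
  have hwu : ∀ᶠ p in 𝓝 (x, t), characteristicValue θ g Y p.1 p.2 ≤ u p := by
    filter_upwards [hpos] with p hp
    exact characteristicValue_le_action hθ hd hg hgd hY p.1 y hp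
  have hlx : l (x, t) = characteristicValue θ g Y x t :=
    (characteristicValue_eq_affine hY x ht).symm
  have hux : u (x, t) = characteristicValue θ g Y x t := by
    rw [characteristicValue, if_pos ht]
  have hld : HasFDerivAt l ((innerSL ℝ (gradient g y)).comp (ContinuousLinearMap.fst ℝ _ ℝ) +
      m • ContinuousLinearMap.snd ℝ _ ℝ) (x, t) := by
    have h1 : HasFDerivAt (fun p : EuclideanSpace ℝ (Fin n) × ℝ => p.1 - y)
        (ContinuousLinearMap.fst ℝ _ ℝ) (x, t) := hasFDerivAt_fst.sub_const y
    have h2 := (((innerSL ℝ (gradient g y)).hasFDerivAt.comp (x, t) h1).const_add (g y)).add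
      (hasFDerivAt_snd.mul_const m)
    exact h2
  have hL : Differentiable ℝ fun q : EuclideanSpace ℝ (Fin n) => θ ‖q‖ :=
    fun q => (hasGradientAt_comp_norm hd hθ.deriv_zero q).differentiableAt
  have hud : DifferentiableAt ℝ u (x, t) := by
    have h1 : DifferentiableAt ℝ (fun p : EuclideanSpace ℝ (Fin n) × ℝ => p.2⁻¹ • (p.1 - y))
        (x, t) := 
      (DifferentiableAt.inv differentiableAt_snd ht.ne').fun_smul (differentiableAt_fst.sub_const y)
    exact (differentiableAt_snd.mul ((hL _).comp (x, t) h1)).const_add (g y)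
  have hmin : IsLocalMin (fun p => u p - l p) (x, t) := by
    filter_upwards [hlw, hwu] with p h1 h2
    simp only [hlx, hux]
    linarith
  have heq := hmin.hasFDerivAt_eq_zero (hud.hasFDerivAt.sub hld)
  rw [sub_eq_zero] at heq
  exact hasFDerivAt_of_squeeze hld (heq ▸ hud.hasFDerivAt) hlw hwu hlx hux

/-- Transport along characteristics satisfying the first order condition is a classical
solution. -/
theorem isClassicalSolution_characteristicValue
    (hθ : IsConvexCost θ) (hd : Differentiable ℝ θ) (hsup : Superlinear θ)
    (hg : ConvexOn ℝ univ g) (hgd : Differentiable ℝ g)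
    {Y : EuclideanSpace ℝ (Fin n) → ℝ → EuclideanSpace ℝ (Fin n)}
    (hY : ∀ x t, 0 < t → gradient g (Y x t) = radial (deriv θ) (t⁻¹ • (x - Y x t))) :
    IsClassicalSolution θ g (characteristicValue θ g Y) := by
  have hdiff := fun x t ht => hasFDerivAt_characteristicValue hθ hd hg hgd hY x (t := t) ht
  have hinit : ∀ x, characteristicValue θ g Y x 0 = g x := fun x => by
    simp [characteristicValue]
  have hup : ∀ x t, 0 ≤ t → characteristicValue θ g Y x t ≤ g x := by
    intro x t ht
    rcases ht.eq_or_lt with rfl | ht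
    · exact (hinit x).le
    · simpa [hθ.zero] using characteristicValue_le_action hθ hd hg hgd hY x x ht
  -- The solution started from the tangent plane of `g` at `x₀` is a lower barrier; with the upper
  -- bound `g x` it gives continuity at time `0`.
  have hlow : ∀ x₀ x t, 0 ≤ t → g x₀ + inner ℝ (gradient g x₀) (x - x₀) -
      t * conjugate θ ‖gradient g x₀‖ ≤ characteristicValue θ g Y x t := by
    intro x₀ x t ht
    rcases ht.eq_or_lt with rfl | ht
    · rw [hinit, zero_mul, sub_zero]
      exact convex_tangent hg hgd x₀ x
    · rw [characteristicValue, if_pos ht]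
      set y := Y x t
      set q := t⁻¹ • (x - y) with hq
      have h1 := convex_tangent hg hgd x₀ y
      have h2 := mul_le_mul_of_nonneg_left
        (hθ.le_conjugate hd hsup (norm_nonneg (gradient g x₀)) ‖q‖) ht.le
      have h3 := mul_le_mul_of_nonneg_left (real_inner_le_norm (gradient g x₀) q) ht.le
      rw [← real_inner_smul_right, hq, smul_inv_smul₀ ht.ne', ← hq, inner_sub_right] at h3
      rw [inner_sub_right] at h1 ⊢
      linarith
  refine ⟨?_, hinit, fun x t ht => (hdiff x t ht).differentiableAt, fun x t ht => ?_⟩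
  · rintro ⟨x₀, t₀⟩ ⟨-, ht₀⟩
    rcases (mem_Ici.1 ht₀).eq_or_lt with rfl | ht₀
    · have hA : Tendsto (fun p : EuclideanSpace ℝ (Fin n) × ℝ =>
          g x₀ + inner ℝ (gradient g x₀) (p.1 - x₀) - p.2 * conjugate θ ‖gradient g x₀‖)
          (𝓝[univ ×ˢ Ici 0] (x₀, 0)) (𝓝 (g x₀)) := by
        have : Continuous (fun p : EuclideanSpace ℝ (Fin n) × ℝ =>
          g x₀ + inner ℝ (gradient g x₀) (p.1 - x₀) - p.2 * conjugate θ ‖gradient g x₀‖) := by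
          fun_prop
        have h := (this.tendsto (x₀, 0)).mono_left (nhdsWithin_le_nhds (s := univ ×ˢ Ici 0))
        simpa using h
      have hB : Tendsto (fun p : EuclideanSpace ℝ (Fin n) × ℝ => g p.1)
          (𝓝[univ ×ˢ Ici 0] (x₀, 0)) (𝓝 (g x₀)) :=
        ((hgd.continuous.comp continuous_fst).tendsto (x₀, 0)).mono_left nhdsWithin_le_nhds
      rw [ContinuousWithinAt]
      simp only [hinit]
      refine tendsto_of_tendsto_of_tendsto_of_le_of_le' hA hB ?_ ?_
      · filter_upwards [self_mem_nhdsWithin] with p hp using hlow x₀ p.1 p.2 hp.2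
      · filter_upwards [self_mem_nhdsWithin] with p hp using hup p.1 p.2 hp.2
    · exact (hdiff x₀ t₀ ht₀).continuousAt.continuousWithinAt
  · rw [hjOperator_of_hasFDerivAt (hdiff x t ht)]
    set y := Y x t with hy
    set q := t⁻¹ • (x - y) with hq
    have e : (InnerProductSpace.toDual ℝ (EuclideanSpace ℝ (Fin n))).symm
        (((innerSL ℝ (gradient g y)).comp (ContinuousLinearMap.fst ℝ _ ℝ) +
          (θ ‖q‖ - deriv θ ‖q‖ * ‖q‖) • ContinuousLinearMap.snd ℝ _ ℝ).comp
            (ContinuousLinearMap.inl ℝ _ ℝ)) = radial (deriv θ) q := by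
      rw [LinearIsometryEquiv.symm_apply_eq, ← hY x t ht]
      ext w
      simp [y]
    rw [e, norm_radial hθ.deriv_zero fun r hr => hθ.deriv_nonneg hd hr, hθ.conjugate_deriv hd]
    simp
    ring

end

end HamiltonJacobi

end

/-! ### The decomposition. -/

theorem theorem7 (n : ℕ) (θ : ℝ → ℝ)
    (hθ : HamiltonJacobi.IsConvexCost θ)
    (hθ_strict : StrictConvexOn ℝ univ θ)
    (hθ_diff : Differentiable ℝ θ)
    (hθ_super : HamiltonJacobi.Superlinear θ)
    (f : EuclideanSpace ℝ (Fin n) → ℝ)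
    (hf : HamiltonJacobi.ClassF f)
    (v : EuclideanSpace ℝ (Fin n) → ℝ → ℝ)
    (hv : HamiltonJacobi.IsViscositySolution θ f v)
    (θ₁ θ₂ : ℝ → ℝ)
    (hθ₁ : HamiltonJacobi.IsConvexCost θ₁)
    (hθ₂ : HamiltonJacobi.IsConvexCost θ₂)
    (hθ₁_super : HamiltonJacobi.Superlinear θ₁)
    (hθ₂_super : HamiltonJacobi.Superlinear θ₂)
    (hsum : ∀ r, θ₁ r + θ₂ r = θ r)
    (hreg : ∃ G : ℝ → ℝ, ContDiff ℝ 1 G ∧ ∀ r, 0 ≤ r → deriv θ₁ r = G (deriv θ r)) :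
    ∃ (f₁ f₂ : EuclideanSpace ℝ (Fin n) → ℝ) (v₁ v₂ : EuclideanSpace ℝ (Fin n) → ℝ → ℝ),
      HamiltonJacobi.ClassF f₁ ∧ HamiltonJacobi.ClassF f₂ ∧
      HamiltonJacobi.IsViscositySolution θ₁ f₁ v₁ ∧
      HamiltonJacobi.IsViscositySolution θ₂ f₂ v₂ ∧
      HamiltonJacobi.IsClassicalSolution θ₁ f₁ v₁ ∧
      HamiltonJacobi.IsClassicalSolution θ₂ f₂ v₂ ∧
      ∀ x, ∀ t, 0 ≤ t → v x t = v₁ x t + v₂ x t := by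
  open HamiltonJacobi in
  obtain ⟨G, hG, hGθ⟩ := hreg
  have hd₁ : Differentiable ℝ θ₁ := differentiable_of_add hθ₁.convex hθ₂.convex hsum hθ_diff
  have hd₂ : Differentiable ℝ θ₂ := differentiable_of_add hθ₂.convex hθ₁.convex
    (fun r => by rw [add_comm, hsum]) hθ_diff
  set G₂ : ℝ → ℝ := fun s => s - G s with hG₂def
  have hG₂ : ContDiff ℝ 1 G₂ := contDiff_id.sub hG
  have hderiv : ∀ r, deriv θ₁ r + deriv θ₂ r = deriv θ r := fun r => by
    have h := ((hd₁ r).hasDerivAt.add (hd₂ r).hasDerivAt).deriv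
    rw [← h]
    congr 1
    exact funext hsum
  have hG₂θ : ∀ r, 0 ≤ r → deriv θ₂ r = G₂ (deriv θ r) := fun r hr => by
    simp only [hG₂def]
    rw [← hGθ r hr, ← hderiv r, add_sub_cancel_left]
  have hzero : ∀ {θ' : ℝ → ℝ} {K : ℝ → ℝ}, IsConvexCost θ' →
      (∀ r, 0 ≤ r → deriv θ' r = K (deriv θ r)) → K 0 = 0 := fun h hK => by
    rw [← hθ.deriv_zero, ← hK 0 le_rfl, h.deriv_zero, hθ.deriv_zero]
  -- Every `s ≥ 0` is a value of `deriv θ` on `[0, ∞)`, so `K` inherits monotonicity from `deriv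
  -- θ'`.
  have hmono : ∀ {θ' : ℝ → ℝ} {K : ℝ → ℝ}, IsConvexCost θ' → Differentiable ℝ θ' →
      (∀ r, 0 ≤ r → deriv θ' r = K (deriv θ r)) → MonotoneOn K (Ici 0) := by
    intro θ' K h hd' hK s hs s' hs' hss'
    obtain ⟨r, hr, rfl⟩ := hθ.exists_deriv_eq hθ_diff hθ_super hs
    obtain ⟨r', hr', rfl⟩ := hθ.exists_deriv_eq hθ_diff hθ_super hs'
    rw [← hK r hr, ← hK r' hr']
    rcases le_total r r' with hle | hle
    · exact h.monotone_deriv hd' hle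
    · have := le_antisymm hss' (hθ.monotone_deriv hθ_diff hle)
      rw [hK r hr, hK r' hr', this]
  have h0 := hzero hθ₁ hGθ
  have h0₂ := hzero hθ₂ hG₂θ
  obtain ⟨f₁, hf₁⟩ := hf.exists_potential hG h0
  have hfd : Differentiable ℝ f := hf.contDiff.differentiable two_ne_zero
  have hf₂ : ∀ x, HasGradientAt (fun x => f x - f₁ x) (radial G₂ (gradient f x)) x := by
    intro x
    have h := (hfd x).hasGradientAt.hasFDerivAt.sub (hf₁ x).hasFDerivAt
    rw [← map_sub] at h
    have e : radial G₂ (gradient f x) = gradient f x - radial G (gradient f x) := by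
      rw [eq_sub_iff_add_eq, ← radial_add]
      simp only [hG₂def, sub_add_cancel]
      exact radial_id _
    rw [e, hasGradientAt_iff_hasFDerivAt]
    exact h
  have hF₁ := hf.of_hasGradientAt hG h0 (hmono hθ₁ hd₁ hGθ) hf₁
  have hF₂ := hf.of_hasGradientAt hG₂ h0₂ (hmono hθ₂ hd₂ hG₂θ) hf₂
  -- The characteristic feet of `v` serve both subproblems, which is why the two values add up to
  -- `v`.
  choose! Y hvY hY using fun (x : EuclideanSpace ℝ (Fin n)) (t : ℝ) (ht : 0 < t) =>
    hv.exists_characteristic hθ hθ_strict hθ_diff hθ_super hfd x ht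
  have hYi : ∀ {θ' : ℝ → ℝ} {K : ℝ → ℝ} {g : EuclideanSpace ℝ (Fin n) → ℝ}, K 0 = 0 →
      (∀ r, 0 ≤ r → deriv θ' r = K (deriv θ r)) →
      (∀ x, HasGradientAt g (radial K (gradient f x)) x) →
      ∀ x t, 0 < t → gradient g (Y x t) = radial (deriv θ') (t⁻¹ • (x - Y x t)) := by
    intro θ' K g hK0 hK hg x t ht
    rw [(hg _).gradient, hY x t ht,
      radial_radial hK0 hθ.deriv_zero fun r hr => hθ.deriv_nonneg hθ_diff hr]
    simp only [radial, Function.comp, hK _ (norm_nonneg _)]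
  have hc₁ := isClassicalSolution_characteristicValue hθ₁ hd₁ hθ₁_super hF₁.convex
    (hF₁.contDiff.differentiable two_ne_zero) (hYi h0 hGθ hf₁)
  have hc₂ := isClassicalSolution_characteristicValue hθ₂ hd₂ hθ₂_super hF₂.convex
    (hF₂.contDiff.differentiable two_ne_zero) (hYi h0₂ hG₂θ hf₂)
  refine ⟨f₁, fun x => f x - f₁ x, _, _, hF₁, hF₂, hc₁.isViscositySolution,
    hc₂.isViscositySolution, hc₁, hc₂, fun x t ht => ?_⟩
  rcases ht.eq_or_lt with rfl | ht
  · rw [hv.initial, hc₁.initial, hc₂.initial]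
    ring
  · rw [characteristicValue, if_pos ht, characteristicValue, if_pos ht, hvY x t ht, ← hsum]
    ring
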